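/- All groups are finite, all classes of groups are closed under isomorphism and non-empty, $\pi$ is a set of primes and $\pi'$ is the set of primes not in $\pi$. A formation is a class closed under homomorphic images and subdirect products; it is saturated if $G/\Phi(G)\in\mathfrak{X}$ implies $G\in\mathfrak{X}$. A Fitting class is a class closed under normal subgroups and under products of normal subgroups belonging to it; a Fitting formation is both. For a formation $\mathfrak{X}$, the residual $G^{\mathfrak{X}}$ is the smallest normal subgroup of $G$ with quotient in $\mathfrak{X}$; for a Fitting class $\mathfrak{H}$, the radical $G_{\mathfrak{H}}$ is the largest normal subgroup of $G$ belonging to $\mathfrak{H}$. Put $\mathfrak{X}\circ\mathfrak{F}=\{G: G^{\mathfrak{F}}\in\mathfrak{X}\}$ and $\mathfrak{H}\diamond\mathfrak{X}=\{G: G/G_{\mathfrak{H}}\in\mathfrak{X}\}$. Let $\mathtt{S}\mathfrak{X}$ be the class of groups isomorphic to a subgroup of an $\mathfrak{X}$-group, and $\mathtt{E}\mathfrak{X}$ the class of groups $G$ having a series $1=G_0\unlhd G_1\unlhd\cdots\unlhd G_n=G$ with all factors $G_i/G_{i-1}\in\mathfrak{X}$. Let $\mathfrak{G}_{\pi'}$,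 $\mathfrak{N}$, $\mathfrak{N}_\pi$, $\mathfrak{S}_\pi$ be the classes of $\pi'$-groups, nilpotent groups, $\pi$-nilpotent groups (groups with a normal $\pi'$-subgroup with nilpotent quotient), and $\pi$-solvable groups (groups with a subnormal series each of whose factors is a $\pi'$-group or a $p$-group for some $p\in\pi$). Let $\mathfrak{H}\diamond\mathfrak{N}\circ\mathfrak{F}$ denote $\mathfrak{H}\diamond(\mathfrak{N}\circ\mathfrak{F})$. A formation $\mathfrak{F}$ satisfies the $\pi$-boundary condition (I) if every group that is not in $\mathfrak{F}$ but all of whose proper subgroups are in $\mathfrak{F}$ belongs to $\mathfrak{N}_\pi\circ\mathfrak{F}$. Let $$\mathcal{N}_{\mathfrak{H},\mathfrak{F}}(G)=\bigcap_{H\le G}N_G(H^{\mathfrak{F}}G_{\mathfrak{H}}),$$ let $\mathcal{N}^0_{\mathfrak{H},\mathfrak{F}}(G)=1$ and $\mathcal{N}^{i}_{\mathfrak{H},\mathfrak{F}}(G)/\mathcal{N}^{i-1}_{\mathfrak{H},\mathfrak{F}}(G)=\mathcal{N}_{\mathfrak{H},\mathfrak{F}}(G/\mathcal{N}^{i-1}_{\mathfrak{H},\mathfrak{F}}(G))$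 for $i\ge 1$, and let $\mathcal{N}^\infty_{\mathfrak{H},\mathfrak{F}}(G)$ be the terminal term of this ascending series. **Theorem A.** Let $\mathfrak{H}$ be a saturated Fitting formation with $\mathfrak{G}_{\pi'}\subseteq\mathfrak{H}=\mathtt{E}\mathfrak{H}$, let $\mathfrak{F}$ be a formation with $\mathfrak{F}=\mathtt{S}\mathfrak{F}$, and let $G$ be a group. Suppose that (i) $G^{\mathfrak{H}\diamond\mathfrak{N}\circ\mathfrak{F}}\in\mathfrak{S}_\pi$, or (ii) $\mathfrak{F}$ satisfies the $\pi$-boundary condition (I). Then the following statements are equivalent: 1. $G\in\mathfrak{H}\diamond\mathfrak{N}\circ\mathfrak{F}$. 2. $G/\mathcal{N}_{\mathfrak{H},\mathfrak{F}}(G)\in\mathfrak{H}\diamond\mathfrak{N}\circ\mathfrak{F}$. 3. $G/\mathcal{N}^\infty_{\mathfrak{H},\mathfrak{F}}(G)\in\mathfrak{H}\diamond\mathfrak{N}\circ\mathfrak{F}$. 4. $\mathcal{N}_{\mathfrak{H},\mathfrak{F}}(G/N)>1$ for every proper normal subgroup $N$ of $G$. 5. $G=\mathcal{N}^\infty_{\mathfrak{H},\mathfrak{F}}(G)$.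 -/

import Mathlib

universe u

/-- A class of finite groups: an isomorphism-closed property of groups, all of whose members are
finite. -/
@[ext]
structure GroupClass : Type (u + 1) where
  /-- Membership of a group in the class. -/
  Mem : (G : Type u) → [Group G] → Prop
  finite_of_mem : ∀ {G : Type u} [Group G], Mem G → Finite G
  mem_of_mulEquiv : ∀ {G K : Type u} [Group G] [Group K], G ≃* K → Mem G → Mem K

namespace GroupClass

/-- Inclusion of classes. -/
instance : LE GroupClass.{u} where
  le X Y := ∀ (G : Type u) [Group G], X.Mem G → Y.Mem G

/-! ### Residuals, radicals, norms -/

/-- The `X`-residual of `G`: the intersection of all normal subgroups `N` of `G` with `G ⧸ N` in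
`X`. If `X` is a formation and `G` is finite, it is the smallest such `N`. -/
def residual (X : GroupClass.{u}) (G : Type u) [Group G] : Subgroup G :=
  sInf {N | ∃ _ : N.Normal, X.Mem (G ⧸ N)}

/-- The `X`-radical of `G`: the join of all normal subgroups of `G` that belong to `X`. If `X` is
a Fitting class and `G` is finite, it is the largest normal `X`-subgroup of `G`. -/
def radical (X : GroupClass.{u}) (G : Type u) [Group G] : Subgroup G :=
  sSup {N | N.Normal ∧ X.Mem N}

/-- The norm: the intersection of the normalizers of the products of the `𝔣`-residual of `H`
with the `𝔥`-radical of `G`, where `H` runs over all subgroups of `G`. (The radical is normal, so the join is the product.) -/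
def norm (𝔥 𝔣 : GroupClass.{u}) (G : Type u) [Group G] : Subgroup G :=
  ⨅ H : Subgroup G, Subgroup.normalizer
    (((𝔣.residual H).map H.subtype ⊔ 𝔥.radical G : Subgroup G) : Set G)

theorem map_residual (X : GroupClass.{u}) {G K : Type u} [Group G] [Group K] (e : G ≃* K) :
    (X.residual G).map e.toMonoidHom = X.residual K := by
  have key : ∀ {A B : Type u} [Group A] [Group B] (f : A ≃* B),
      (X.residual A).map f.toMonoidHom ≤ X.residual B := by
    intro A B _ _ f
    refine le_sInf ?_
    rintro N ⟨hN, hX⟩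
    rw [Subgroup.map_le_iff_le_comap]
    refine sInf_le ⟨hN.comap _, ?_⟩
    refine X.mem_of_mulEquiv (QuotientGroup.congr _ N f ?_).symm hX
    exact Subgroup.map_comap_eq_self_of_surjective f.surjective N
  refine le_antisymm (key e) ?_
  intro x hx
  have h := key e.symm ⟨x, hx, rfl⟩
  exact ⟨_, h, e.apply_symm_apply x⟩

theorem map_radical (X : GroupClass.{u}) {G K : Type u} [Group G] [Group K] (e : G ≃* K) :
    (X.radical G).map e.toMonoidHom = X.radical K := by
  have key : ∀ {A B : Type u} [Group A] [Group B] (f : A ≃* B),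
      (X.radical A).map f.toMonoidHom ≤ X.radical B := by
    intro A B _ _ f
    rw [Subgroup.map_le_iff_le_comap]
    refine sSup_le ?_
    rintro N ⟨hN, hX⟩
    rw [← Subgroup.map_le_iff_le_comap]
    exact le_sSup ⟨hN.map _ f.surjective, X.mem_of_mulEquiv (f.subgroupMap N) hX⟩
  refine le_antisymm (key e) ?_
  intro x hx
  have h := key e.symm ⟨x, hx, rfl⟩
  exact ⟨_, h, e.apply_symm_apply x⟩

instance residual_characteristic (X : GroupClass.{u}) (G : Type u) [Group G] :
    (X.residual G).Characteristic :=
  Subgroup.characteristic_iff_map_eq.2 fun e => X.map_residual e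

instance radical_characteristic (X : GroupClass.{u}) (G : Type u) [Group G] :
    (X.radical G).Characteristic :=
  Subgroup.characteristic_iff_map_eq.2 fun e => X.map_radical e

theorem map_residual_subgroup (X : GroupClass.{u}) {G K : Type u} [Group G] [Group K]
    (e : G ≃* K) (H : Subgroup G) :
    ((X.residual H).map H.subtype).map (e : G →* K) =
      (X.residual (H.map (e : G →* K))).map (H.map (e : G →* K)).subtype := by
  rw [← X.map_residual (e.subgroupMap H), Subgroup.map_map, Subgroup.map_map]
  rfl

instance norm_characteristic (𝔥 𝔣 : GroupClass.{u}) (G : Type u) [Group G] :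
    (norm 𝔥 𝔣 G).Characteristic := by
  refine Subgroup.characteristic_iff_map_le.2 fun e => ?_
  change (norm 𝔥 𝔣 G).map (e : G →* G) ≤ _
  refine le_iInf fun H => ?_
  have hH : (H.map (e.symm : G →* G)).map (e : G →* G) = H := by
    rw [Subgroup.map_map]
    ext x
    simp
  have hR : 𝔥.radical G = (𝔥.radical G).map (e : G →* G) := (𝔥.map_radical e).symm
  rw [← hH, ← map_residual_subgroup, hR, ← Subgroup.map_sup]
  exact (Subgroup.map_mono (iInf_le _ (H.map (e.symm : G →* G)))).trans
    (Subgroup.map_equiv_normalizer_eq _ e).le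

/-- The ascending norm series, bundled with normality: it starts at `1`, and its `(i+1)`-st term
modulo its `i`-th term is the norm of the quotient by the `i`-th term. -/
def normSeriesAux (𝔥 𝔣 : GroupClass.{u}) (G : Type u) [Group G] :
    ℕ → {N : Subgroup G // N.Normal}
  | 0 => ⟨⊥, inferInstance⟩
  | i + 1 =>
    haveI := (normSeriesAux 𝔥 𝔣 G i).2
    ⟨(norm 𝔥 𝔣 (G ⧸ (normSeriesAux 𝔥 𝔣 G i).1)).comap
      (QuotientGroup.mk' (normSeriesAux 𝔥 𝔣 G i).1), inferInstance⟩

/-- The `i`-th term of the ascending norm series. -/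
def normSeries (𝔥 𝔣 : GroupClass.{u}) (G : Type u) [Group G] (i : ℕ) : Subgroup G :=
  (normSeriesAux 𝔥 𝔣 G i).1

instance normSeries_normal (𝔥 𝔣 : GroupClass.{u}) (G : Type u) [Group G] (i : ℕ) :
    (normSeries 𝔥 𝔣 G i).Normal :=
  (normSeriesAux 𝔥 𝔣 G i).2

/-- The terminal term of the ascending norm series, as the join of its terms (in a finite group
the ascending series becomes stationary at this subgroup). -/
def normInfty (𝔥 𝔣 : GroupClass.{u}) (G : Type u) [Group G] : Subgroup G :=
  ⨆ i : ℕ, normSeries 𝔥 𝔣 G i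

instance normInfty_normal (𝔥 𝔣 : GroupClass.{u}) (G : Type u) [Group G] :
    (normInfty 𝔥 𝔣 G).Normal :=
  Subgroup.iSup_normal _

/-! ### Products and closures of classes -/

/-- The formation product `X ∘ F`: all finite groups whose `F`-residual is in `X`. -/
def formationProduct (X 𝔣 : GroupClass.{u}) : GroupClass.{u} where
  Mem G _ := Finite G ∧ X.Mem (𝔣.residual G)
  finite_of_mem h := h.1
  mem_of_mulEquiv {G K} _ _ e h := by
    have := h.1
    refine ⟨Finite.of_equiv G e.toEquiv, ?_⟩
    rw [← 𝔣.map_residual e]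
    exact X.mem_of_mulEquiv (e.subgroupMap _) h.2

/-- The Fitting product `H ◇ X`: all finite groups whose quotient by the `H`-radical is in `X`. -/
def fittingProduct (𝔥 X : GroupClass.{u}) : GroupClass.{u} where
  Mem G _ := Finite G ∧ X.Mem (G ⧸ 𝔥.radical G)
  finite_of_mem h := h.1
  mem_of_mulEquiv {G K} _ _ e h := by
    have := h.1
    exact ⟨Finite.of_equiv G e.toEquiv,
      X.mem_of_mulEquiv (QuotientGroup.congr _ _ e (𝔥.map_radical e)) h.2⟩

/-- `S X`: all groups isomorphic to a subgroup of a member of `X`. -/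
def subgroupClosure (X : GroupClass.{u}) : GroupClass.{u} where
  Mem G _ := ∃ (A : Type u) (_ : Group A) (f : G →* A), X.Mem A ∧ Function.Injective f
  finite_of_mem := by
    rintro G _ ⟨A, _, f, hA, hf⟩
    have := X.finite_of_mem hA
    exact Finite.of_injective f hf
  mem_of_mulEquiv := by
    rintro G K _ _ e ⟨A, _, f, hA, hf⟩
    exact ⟨A, _, f.comp e.symm.toMonoidHom, hA, hf.comp e.symm.injective⟩

/-- `E X`: all finite groups `G` with a series `1 = G_0 ⊴ G_1 ⊴ ⋯ ⊴ G_n = G` all of whose factors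
`G_{i+1} / G_i` are in `X`. -/
def extensionClosure (X : GroupClass.{u}) : GroupClass.{u} where
  Mem G _ := Finite G ∧ ∃ (n : ℕ) (s : ℕ → Subgroup G), s 0 = ⊥ ∧ s n = ⊤ ∧
    ∀ i < n, s i ≤ s (i + 1) ∧ ∃ _ : ((s i).subgroupOf (s (i + 1))).Normal,
      X.Mem (s (i + 1) ⧸ (s i).subgroupOf (s (i + 1)))
  finite_of_mem h := h.1
  mem_of_mulEquiv := by
    rintro G K _ _ e ⟨hfin, n, s, h0, hn, hs⟩
    refine ⟨Finite.of_equiv G e.toEquiv, n, fun i => (s i).map e.toMonoidHom, ?_, ?_, ?_⟩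
    · simp [h0]
    · simp only [hn]
      exact Subgroup.map_top_of_surjective _ e.surjective
    · intro i hi
      obtain ⟨hle, hnor, hX⟩ := hs i hi
      have hmap : ((s i).subgroupOf (s (i + 1))).map
          ((e.subgroupMap (s (i + 1))).toMonoidHom) =
          ((s i).map e.toMonoidHom).subgroupOf ((s (i + 1)).map e.toMonoidHom) := by
        ext ⟨y, hy⟩
        simp only [Subgroup.mem_map, Subgroup.mem_subgroupOf]
        constructor
        · rintro ⟨x, hx, hxy⟩
          exact ⟨x, hx, congrArg Subtype.val hxy⟩
        · rintro ⟨x, hx, hxy⟩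
          exact ⟨⟨x, hle hx⟩, hx, Subtype.ext hxy⟩
      have hnor' : (((s i).map e.toMonoidHom).subgroupOf
          ((s (i + 1)).map e.toMonoidHom)).Normal := by
        rw [← hmap]
        exact hnor.map _ (e.subgroupMap (s (i + 1))).surjective
      exact ⟨Subgroup.map_mono hle, hnor',
        X.mem_of_mulEquiv (QuotientGroup.congr _ _ (e.subgroupMap (s (i + 1))) hmap) hX⟩

/-- `Crit_S(X)`: the finite groups that are not in `X` while all their proper subgroups are. -/
def critical (X : GroupClass.{u}) : GroupClass.{u} where
  Mem G _ := Finite G ∧ ¬ X.Mem G ∧ ∀ H : Subgroup G, H ≠ ⊤ → X.Mem H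
  finite_of_mem h := h.1
  mem_of_mulEquiv := by
    rintro G K _ _ e ⟨hfin, hG, hH⟩
    refine ⟨Finite.of_equiv G e.toEquiv, fun h => hG (X.mem_of_mulEquiv e.symm h), ?_⟩
    intro H hne
    refine X.mem_of_mulEquiv (e.symm.subgroupMap H).symm (hH _ fun htop => hne ?_)
    refine eq_top_iff.2 fun x _ => ?_
    have hx : e.symm x ∈ H.map e.symm.toMonoidHom := by
      have : H.map (e.symm : K →* G) = ⊤ := htop
      exact this ▸ Subgroup.mem_top _
    obtain ⟨y, hy, hyx⟩ := hx
    exact e.symm.injective hyx ▸ hy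

/-! ### Properties of classes -/

/-- Formations: non-empty classes closed under homomorphic images and subdirect products. -/
structure IsFormation (X : GroupClass.{u}) : Prop where
  nonempty : ∃ (G : Type u) (_ : Group G), X.Mem G
  image : ∀ {G K : Type u} [Group G] [Group K] (f : G →* K),
    Function.Surjective f → X.Mem G → X.Mem K
  subdirect : ∀ {A B : Type u} [Group A] [Group B] (D : Subgroup (A × B)),
    D.map (MonoidHom.fst A B) = ⊤ → D.map (MonoidHom.snd A B) = ⊤ →
    X.Mem A → X.Mem B → X.Mem D

/-- Saturation: `G` is in the class whenever `G / Φ(G)` is. -/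
def IsSaturated (X : GroupClass.{u}) : Prop :=
  ∀ (G : Type u) [Group G] [Finite G], X.Mem (G ⧸ frattini G) → X.Mem G

/-- Fitting classes: non-empty classes closed under normal subgroups and products of normal
subgroups. -/
structure IsFittingClass (X : GroupClass.{u}) : Prop where
  nonempty : ∃ (G : Type u) (_ : Group G), X.Mem G
  normal : ∀ {G : Type u} [Group G] (N : Subgroup G), N.Normal → X.Mem G → X.Mem N
  sup : ∀ {G : Type u} [Group G] [Finite G] (M N : Subgroup G), M.Normal → N.Normal →
    X.Mem M → X.Mem N → X.Mem (M ⊔ N : Subgroup G)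

/-! ### Particular classes -/

/-- The class of finite nilpotent groups. -/
def nilpotentGroups : GroupClass.{u} where
  Mem G _ := Finite G ∧ Group.IsNilpotent G
  finite_of_mem h := h.1
  mem_of_mulEquiv {G K} _ _ e h := by
    have := h.1
    have := h.2
    exact ⟨Finite.of_equiv G e.toEquiv, Group.nilpotent_of_mulEquiv e⟩

/-- The class of finite `π`-groups: all prime divisors of the order are in `π`. -/
def piGroups (π : Set Nat.Primes) : GroupClass.{u} where
  Mem G _ := Finite G ∧ ∀ p : Nat.Primes, (p : ℕ) ∣ Nat.card G → p ∈ π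
  finite_of_mem h := h.1
  mem_of_mulEquiv {G K} _ _ e h := by
    have := h.1
    refine ⟨Finite.of_equiv G e.toEquiv, fun p hp => h.2 p ?_⟩
    rwa [Nat.card_congr e.toEquiv]

/-- The class of the finite groups that are `π'`-groups or `p`-groups for some `p ∈ π`. -/
def piSolvableFactors (π : Set Nat.Primes) : GroupClass.{u} where
  Mem G _ := Finite G ∧ ((piGroups πᶜ).Mem G ∨ ∃ p ∈ π, IsPGroup (p : ℕ) G)
  finite_of_mem h := h.1
  mem_of_mulEquiv {G K} _ _ e h := by
    have := h.1
    refine ⟨Finite.of_equiv G e.toEquiv, ?_⟩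
    rcases h.2 with h | ⟨p, hp, h⟩
    · exact Or.inl ((piGroups πᶜ).mem_of_mulEquiv e h)
    · exact Or.inr ⟨p, hp, h.of_equiv e⟩

/-- The class of finite `π`-solvable groups: those with a subnormal series each of whose factors is
a `π'`-group or a `p`-group for some `p ∈ π`. -/
def piSolvableGroups (π : Set Nat.Primes) : GroupClass.{u} :=
  extensionClosure (piSolvableFactors π)

/-- The class of finite `π`-nilpotent groups: those with a normal `π'`-subgroup with nilpotent
quotient. -/
def piNilpotentGroups (π : Set Nat.Primes) : GroupClass.{u} where
  Mem G _ := Finite G ∧ ∃ (N : Subgroup G) (_ : N.Normal),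
    (piGroups πᶜ).Mem N ∧ Group.IsNilpotent (G ⧸ N)
  finite_of_mem h := h.1
  mem_of_mulEquiv := by
    rintro G K _ _ e ⟨hfin, N, hN, hπ, hnil⟩
    have hN' : (N.map e.toMonoidHom).Normal := hN.map _ e.surjective
    exact ⟨Finite.of_equiv G e.toEquiv, N.map e.toMonoidHom, hN',
      (piGroups πᶜ).mem_of_mulEquiv (e.subgroupMap N) hπ,
      Group.nilpotent_of_mulEquiv (QuotientGroup.congr N (N.map e.toMonoidHom) e rfl)⟩

/-- The `π`-boundary condition (I): `Crit_S(F) ⊆ N_π ∘ F`. -/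
def PiBoundaryI (π : Set Nat.Primes) (𝔣 : GroupClass.{u}) : Prop :=
  𝔣.critical ≤ (piNilpotentGroups π).formationProduct 𝔣

/-- The class `H ◇ N ∘ F`, that is, `H ◇ (N ∘ F)`. -/
def fittingNilpotentProduct (𝔥 𝔣 : GroupClass.{u}) : GroupClass.{u} :=
  𝔥.fittingProduct (nilpotentGroups.formationProduct 𝔣)

end GroupClass

/-!
Write `Y` for `𝔥 ◇ 𝔑 ∘ 𝔣`. The heart of the matter is that `G` lies in `Y` as soon as every
nontrivial quotient of `G` has a nontrivial norm. Otherwise some quotient `Q` of `G` is minimal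
outside `Y`; its `Y`-residual `M` is then the monolith of `Q`, and the `𝔥`-radical of `Q` is
trivial because `𝔥` is closed under extensions. Hence `M` lies in the norm of `Q`, that is, it
normalizes the `𝔣`-residuals of all subgroups of `Q`.

If `M ≤ Φ(Q)`, then `M` is an abelian `q`-group. As `𝔥` is a saturated Fitting formation, it
contains the group of order `q` once `q` divides the order of one of its members, so `q` does not
divide the order of the `𝔥`-radical of `Q ⧸ M`. The preimage of this radical splits over `M`,
normally in `Q` since `M ≤ Φ(Q)`, and so the radical is trivial. Therefore the `𝔣`-residual of
`Q ⧸ M` is nilpotent, and with it that of `Q`.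

If `M ≰ Φ(Q)`, a supplement of `M` shows that the `𝔣`-residual of `Q` is contained in `M`. Either
of the two alternative assumptions provides a subnormal `π'`- or `q`-subgroup of `M`; since `𝔥`
contains all `π'`-groups, `M` is a `q`-group and the `𝔣`-residual of `Q` is again nilpotent. In
both cases `Q` belongs to `Y`.
-/

/-! ### Covers whose kernel is the set of solutions of `yⁿ = 1` -/

/-- The subgroup `[G, G] Gⁿ`, the kernel of the largest abelian quotient of `G` of exponent dividing
`n`, encoded as the preimage of the `n`-th powers of the abelianization. -/
def commutatorPow (G : Type*) [Group G] (n : ℕ) : Subgroup G :=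
  (powMonoidHom n : Abelianization G →* Abelianization G).range.comap Abelianization.of

theorem pow_mem_commutatorPow {G : Type*} [Group G] (n : ℕ) (g : G) : g ^ n ∈ commutatorPow G n :=
  ⟨Abelianization.of g, (map_pow _ g n).symm⟩

theorem exists_map_eq_pow_of_mem_commutatorPow {G A : Type*} [Group G] [CommGroup A] (φ : G →* A)
    {n : ℕ} {g : G} (hg : g ∈ commutatorPow G n) : ∃ h : G, φ g = φ h ^ n := by
  obtain ⟨a, ha⟩ := hg
  obtain ⟨h, rfl⟩ := QuotientGroup.mk_surjective a
  exact ⟨h, (congrArg (Abelianization.lift φ) ha).symm.trans (map_pow _ _ n)⟩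

instance commutatorPow_characteristic (G : Type*) [Group G] (n : ℕ) :
    (commutatorPow G n).Characteristic := by
  refine Subgroup.characteristic_iff_le_comap.2 fun e g ⟨a, ha⟩ =>
    ⟨Abelianization.map e.toMonoidHom a, ?_⟩
  rw [powMonoidHom_apply] at ha ⊢
  rw [← map_pow, ha]
  exact Abelianization.map_of _ _

theorem finite_quotient_commutatorPow (G : Type*) [Group G] [Group.FG G] {n : ℕ} (hn : n ≠ 0) :
    Finite (G ⧸ commutatorPow G n) := by
  let : CommGroup (G ⧸ commutatorPow G n) :=
    { mul_comm := by
        rintro ⟨a⟩ ⟨b⟩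
        refine QuotientGroup.eq.2 ⟨1, ?_⟩
        rw [map_one, map_mul, map_inv, map_mul, map_mul, mul_comm (Abelianization.of b),
          inv_mul_cancel] }
  refine CommGroup.finite_of_fg_isMulTorsion _ ?_
  rintro ⟨a⟩
  exact isOfFinOrder_iff_pow_eq_one.2
    ⟨n, hn.bot_lt, (QuotientGroup.eq_one_iff _).2 (pow_mem_commutatorPow n a)⟩

theorem exists_comp_eq_of_isFreeGroup {F A B : Type*} [Group F] [IsFreeGroup F] [Group A]
    [Group B] (p : A →* B) (g : F →* B) (h : g.range ≤ p.range) : ∃ g' : F →* A, p.comp g' = g := by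
  choose a ha using fun x : IsFreeGroup.Generators F => h ⟨IsFreeGroup.of x, rfl⟩
  exact ⟨IsFreeGroup.lift a, IsFreeGroup.ext_hom fun x => by simp [ha]⟩

/-- Let `F₀` be the preimage of `⟨f y⟩`. Being free, `F₀` maps to the infinite cyclic group over
`⟨f y⟩`; there `yⁿ` and the `n`-th power of some `r ∈ ker f` have the same image, and hence so do
`y` and `r`. -/
theorem map_eq_one_of_pow_mem_map_commutatorPow {F L : Type*} [Group F] [IsFreeGroup F] [Group L]
    (f : F →* L) {n : ℕ} (hn : n ≠ 0) {y : F}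
    (hy : y ^ n ∈ (commutatorPow f.ker n).map f.ker.subtype) : f y = 1 := by
  let F₀ : Subgroup F := (Subgroup.zpowers (f y)).comap f
  have hker : f.ker ≤ F₀ := MonoidHom.ker_le_comap f _
  let y₀ : F₀ := ⟨y, Subgroup.mem_zpowers (f y)⟩
  obtain ⟨ψ, hψ⟩ := exists_comp_eq_of_isFreeGroup (zpowersHom L (f y)) (f.comp F₀.subtype)
    (by rintro _ ⟨x, rfl⟩; exact x.2)
  obtain ⟨r, hr, hry⟩ := hy
  obtain ⟨s, hs⟩ := exists_map_eq_pow_of_mem_commutatorPow (ψ.comp (Subgroup.inclusion hker)) hr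
  have hrs : ψ y₀ ^ n = ψ (Subgroup.inclusion hker s) ^ n := by
    rw [← map_pow, ← MonoidHom.comp_apply, ← hs, MonoidHom.comp_apply]
    exact congrArg ψ (Subtype.ext hry.symm)
  calc f y = zpowersHom L (f y) (ψ y₀) := (DFunLike.congr_fun hψ y₀).symm
    _ = zpowersHom L (f y) (ψ (Subgroup.inclusion hker s)) := by
        rw [pow_left_injective hn hrs]
    _ = f s := DFunLike.congr_fun hψ _
    _ = 1 := s.2

theorem exists_surjective_pow_eq_one_iff (L : Type u) [Group L] [Finite L] {n : ℕ} (hn : n ≠ 0) :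
    ∃ (E : Type u) (_ : Group E) (_ : Finite E) (f : E →* L), Function.Surjective f ∧
      ∀ y, y ^ n = 1 ↔ f y = 1 := by
  let g : FreeGroup L →* L := FreeGroup.lift id
  have hg : Function.Surjective g := fun l => ⟨FreeGroup.of l, FreeGroup.lift_apply_of⟩
  let V : Subgroup (FreeGroup L) := (commutatorPow g.ker n).map g.ker.subtype
  have hVg : V ≤ g.ker := Subgroup.map_subtype_le _
  have : g.ker.FiniteIndex := Subgroup.finiteIndex_ker g
  have : Finite (g.ker ⧸ V.subgroupOf g.ker) := by
    rw [Subgroup.subgroupOf, Subgroup.comap_map_eq_self_of_injective g.ker.subtype_injective]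
    exact finite_quotient_commutatorPow g.ker hn
  have hV : V.index ≠ 0 := by
    rw [← Subgroup.relIndex_mul_index hVg]
    exact mul_ne_zero (Subgroup.index_ne_zero_of_finite) Subgroup.index_ne_zero_of_finite
  have : V.FiniteIndex := ⟨hV⟩
  refine ⟨FreeGroup L ⧸ V, inferInstance, inferInstance, QuotientGroup.lift V g hVg,
    QuotientGroup.lift_surjective_of_surjective V g hg hVg, ?_⟩
  rintro ⟨y⟩
  refine ⟨fun hy => map_eq_one_of_pow_mem_map_commutatorPow g hn
    ((QuotientGroup.eq_one_iff _).1 hy), fun hy => (QuotientGroup.eq_one_iff _).2 ?_⟩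
  exact ⟨⟨y, hy⟩ ^ n, pow_mem_commutatorPow n _, rfl⟩

theorem exists_subgroup_ker_le_frattini {E L : Type*} [Group E] [Finite E] [Group L] (f : E →* L)
    (hf : Function.Surjective f) :
    ∃ U : Subgroup E, Function.Surjective (f.comp U.subtype) ∧
      (f.comp U.subtype).ker ≤ frattini U := by
  obtain ⟨U, hU, hmin⟩ := Set.Finite.exists_minimal (Set.toFinite {U : Subgroup E | U.map f = ⊤})
    ⟨⊤, Subgroup.map_top_of_surjective f hf⟩
  have hs : Function.Surjective (f.comp U.subtype) := by
    rw [← MonoidHom.range_eq_top, MonoidHom.range_comp, Subgroup.range_subtype]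
    exact hU
  refine ⟨U, hs, le_iInf₂ fun V hV => ?_⟩
  by_contra hle
  have hsup : V ⊔ (f.comp U.subtype).ker = ⊤ := hV.2 _ (left_lt_sup.2 hle)
  have hmap : (V.map U.subtype).map f = ⊤ := by
    rw [Subgroup.map_map, ← Subgroup.map_top_of_surjective _ hs, ← hsup, Subgroup.map_sup,
      (Subgroup.map_eq_bot_iff _).2 le_rfl, sup_bot_eq]
  have hUV : U ≤ V.map U.subtype := hmin hmap (Subgroup.map_subtype_le V)
  refine hV.1 ((Subgroup.map_subtype_le_map_subtype (G' := U)).1 ?_ |> top_le_iff.1)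
  rwa [← MonoidHom.range_eq_map, Subgroup.range_subtype]

/-! ### Consequences of the Frattini argument -/

theorem isNilpotent_iff_forall_sylow_normal {G : Type*} [Group G] [Finite G] :
    Group.IsNilpotent G ↔
      ∀ (p : ℕ) (_ : Fact p.Prime) (P : Sylow p G), (P : Subgroup G).Normal :=
  Group.isNilpotent_of_finite_tfae.out 0 3

theorem normalizer_map_sylow_sup_eq_top {G : Type*} [Group G] [Finite G] {p : ℕ} [Fact p.Prime]
    {D N : Subgroup G} [D.Normal] [N.Normal] (P : Sylow p D)
    (hP : (P : Subgroup D).map D.subtype ≤ N) :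
    Subgroup.normalizer ((P : Subgroup D).map D.subtype : Set G) ⊔ N = ⊤ := by
  let i : ↥(N ⊓ D) →* D := Subgroup.inclusion inf_le_right
  have hi : (P : Subgroup D) ≤ i.range := fun x hx => ⟨⟨x, hP ⟨x, hx, rfl⟩, x.2⟩, rfl⟩
  let Q : Sylow p ↥(N ⊓ D) := P.comapOfInjective i (Subgroup.inclusion_injective _) hi
  have hQ : (Q : Subgroup ↥(N ⊓ D)).map (N ⊓ D).subtype = (P : Subgroup D).map D.subtype := by
    have hcomp : (N ⊓ D).subtype = D.subtype.comp i := rfl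
    rw [hcomp, ← Subgroup.map_map, Sylow.coe_comapOfInjective, Subgroup.map_comap_eq_self hi]
  rw [eq_top_iff, ← Sylow.normalizer_sup_eq_top Q, hQ]
  exact sup_le_sup_left inf_le_left _

theorem normal_map_sylow_of_sup_frattini {G : Type*} [Group G] [Finite G] {p : ℕ} [Fact p.Prime]
    {D M : Subgroup G} [D.Normal] (hM : M ≤ frattini G) (P : Sylow p D)
    (hPM : ((P : Subgroup D).map D.subtype ⊔ M).Normal) :
    ((P : Subgroup D).map D.subtype).Normal := by
  rw [← Subgroup.normalizer_eq_top_iff]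
  refine frattini_nongenerating (eq_top_iff.2 ?_)
  rw [← normalizer_map_sylow_sup_eq_top P (le_sup_left (b := M))]
  exact sup_le le_sup_left
    (sup_le (Subgroup.le_normalizer.trans le_sup_left) (hM.trans le_sup_right))

theorem isNilpotent_of_map_mk_of_le_frattini {G : Type*} [Group G] [Finite G] (D M : Subgroup G)
    [D.Normal] [M.Normal] (hM : M ≤ frattini G)
    (h : Group.IsNilpotent (D.map (QuotientGroup.mk' M))) : Group.IsNilpotent D := by
  rw [isNilpotent_iff_forall_sylow_normal] at h ⊢
  intro p hp P
  let Q := P.mapSurjective ((QuotientGroup.mk' M).subgroupMap_surjective D)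
  have hQ : Q.toSubgroup.Characteristic := Sylow.characteristic_of_normal Q (h p hp Q)
  have hDn : (D.map (QuotientGroup.mk' M)).Normal :=
    Subgroup.Normal.map inferInstance _ (QuotientGroup.mk'_surjective M)
  have hQn : (Q.toSubgroup.map (D.map (QuotientGroup.mk' M)).subtype).Normal := inferInstance
  have hPM : ((P : Subgroup D).map D.subtype ⊔ M).Normal := by
    have hcomap := hQn.comap (QuotientGroup.mk' M)
    have hcomp : (D.map (QuotientGroup.mk' M)).subtype.comp ((QuotientGroup.mk' M).subgroupMap D) =
      (QuotientGroup.mk' M).comp D.subtype := rfl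
    rwa [Sylow.coe_mapSurjective, Subgroup.map_map, hcomp, ← Subgroup.map_map,
      Subgroup.comap_map_eq, QuotientGroup.ker_mk'] at hcomap
  exact (normal_map_sylow_of_sup_frattini hM P hPM).of_map_subtype

section Pointwise

open scoped Pointwise

theorem exists_eq_stabilizer_of_isComplement' {G : Type*} [Group G] [Finite G] {H K : Subgroup G}
    [IsMulCommutative H] [H.Normal] (hH : (Nat.card H).Coprime H.index)
    (hK : Subgroup.IsComplement' H K) : ∃ α : H.QuotientDiff, K = MulAction.stabilizer G α := by
  let T : H.LeftTransversal := ⟨K, hK.symm⟩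
  refine ⟨Quotient.mk'' T, Subgroup.eq_of_le_of_card_ge (fun g hg => ?_) ?_⟩
  · have hT : MulOpposite.op g⁻¹ • T = T := Subtype.ext (op_smul_coe_set (K.inv_mem hg))
    exact congrArg Quotient.mk'' hT
  · have hcard :=
      (Subgroup.isComplement'_stabilizer_of_coprime (α := Quotient.mk'' T) hH).card_mul_card
    exact (Nat.eq_of_mul_eq_mul_left Nat.card_pos (hcard.trans hK.card_mul_card.symm)).le

theorem exists_conj_smul_eq_of_isComplement' {G : Type*} [Group G] [Finite G]
    {H K K' : Subgroup G} [IsMulCommutative H] [H.Normal] (hH : (Nat.card H).Coprime H.index)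
    (hK : Subgroup.IsComplement' H K) (hK' : Subgroup.IsComplement' H K') :
    ∃ h ∈ H, MulAut.conj h • K = K' := by
  obtain ⟨α, rfl⟩ := exists_eq_stabilizer_of_isComplement' hH hK
  obtain ⟨β, rfl⟩ := exists_eq_stabilizer_of_isComplement' hH hK'
  obtain ⟨h, rfl⟩ := Subgroup.exists_smul_eq hH α β
  exact ⟨h, h.2, (MulAction.stabilizer_smul_eq_stabilizer_map_conj (h : G) α).symm⟩

theorem mem_normalizer_map_subtype_iff {G : Type*} [Group G] {R : Subgroup G} [R.Normal]
    {K : Subgroup R} {g : G} :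
    g ∈ Subgroup.normalizer (K.map R.subtype : Set G) ↔
      (MulAut.conjNormal g : MulAut R) • K = K := by
  have hsmul : (K.map R.subtype).map (MulAut.conj g : G →* G) =
      ((MulAut.conjNormal g : MulAut R) • K).map R.subtype := by
    rw [Subgroup.map_map]
    exact (Subgroup.map_map K R.subtype (MulAut.conjNormal g : MulAut R).toMonoidHom).symm
  rw [Subgroup.mem_normalizer_iff_map_conj_eq, hsmul]
  exact (Subgroup.map_injective R.subtype_injective).eq_iff

theorem isComplement'_smul_of_coprime {R : Type*} [Group R] [Finite R] {N K : Subgroup R}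
    (hN : (Nat.card N).Coprime N.index) (hK : Subgroup.IsComplement' N K) (φ : MulAut R) :
    Subgroup.IsComplement' N (φ • K) := by
  have hcard : Nat.card ↥(φ • K) = Nat.card K :=
    Nat.card_congr (Subgroup.equivSMul φ K).toEquiv.symm
  refine Subgroup.isComplement'_of_coprime (hcard ▸ hK.card_mul_card) ?_
  rwa [hcard, ← hK.symm.index_eq_card]

theorem exists_normal_complement_of_le_frattini {G : Type*} [Group G] [Finite G]
    {M R : Subgroup G} [M.Normal] [R.Normal] [IsMulCommutative M] (hMR : M ≤ R)
    (hM : M ≤ frattini G) (hco : (Nat.card M).Coprime (M.relIndex R)) :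
    ∃ L : Subgroup G, L.Normal ∧ L ⊓ M = ⊥ ∧ L ⊔ M = R := by
  set N : Subgroup R := M.subgroupOf R with hN
  have hcoN : (Nat.card N).Coprime N.index := by
    rwa [Nat.card_congr (Subgroup.subgroupOfEquivOfLe hMR).toEquiv]
  obtain ⟨K, hK⟩ := Subgroup.exists_right_complement'_of_coprime hcoN
  have hmapN : N.map R.subtype = M := by
    rw [hN, Subgroup.subgroupOf_map_subtype, inf_eq_left.2 hMR]
  refine ⟨K.map R.subtype, ?_, ?_, ?_⟩
  · rw [← Subgroup.normalizer_eq_top_iff]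
    refine frattini_nongenerating (eq_top_iff.2 fun g _ => ?_)
    obtain ⟨h, hhN, hh⟩ := exists_conj_smul_eq_of_isComplement' hcoN hK
      (isComplement'_smul_of_coprime hcoN hK (MulAut.conjNormal g))
    have hg : (h : G)⁻¹ * g ∈ Subgroup.normalizer (K.map R.subtype : Set G) := by
      rw [mem_normalizer_map_subtype_iff, map_mul, mul_smul, ← hh, map_inv,
        MulAut.conjNormal_val, inv_smul_smul]
    rw [← mul_inv_cancel_left (h : G) g]
    exact mul_mem (Subgroup.mem_sup_right (hM hhN)) (Subgroup.mem_sup_left hg)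
  · rw [← hmapN, ← Subgroup.map_inf _ _ _ R.subtype_injective, hK.symm.disjoint.eq_bot,
      Subgroup.map_bot]
  · rw [← hmapN, ← Subgroup.map_sup, hK.symm.sup_eq_top, ← MonoidHom.range_eq_map,
      Subgroup.range_subtype]

end Pointwise

namespace GroupClass

variable {X 𝔥 𝔣 : GroupClass.{u}} {π : Set Nat.Primes}

/-! ### Formations -/

theorem IsFormation.mem_of_subsingleton (hX : X.IsFormation) (G : Type u) [Group G]
    [Subsingleton G] : X.Mem G := by
  obtain ⟨A, _, hA⟩ := hX.nonempty
  exact hX.image (1 : A →* G) (fun x => ⟨1, Subsingleton.elim _ _⟩) hA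

theorem IsFormation.mem_of_ker_inf_le (hX : X.IsFormation) {G A B K : Type u} [Group G] [Group A]
    [Group B] [Group K] (f : G →* A) (g : G →* B) (k : G →* K) (hf : Function.Surjective f)
    (hg : Function.Surjective g) (hk : Function.Surjective k) (h : f.ker ⊓ g.ker ≤ k.ker)
    (hA : X.Mem A) (hB : X.Mem B) : X.Mem K := by
  have hD : X.Mem (f.prod g).range := by
    refine hX.subdirect _ ?_ ?_ hA hB
    · rw [← MonoidHom.range_comp, MonoidHom.fst_comp_prod, MonoidHom.range_eq_top.2 hf]
    · rw [← MonoidHom.range_comp, MonoidHom.snd_comp_prod, MonoidHom.range_eq_top.2 hg]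
  have hQ : X.Mem (G ⧸ (f.prod g).ker) :=
    X.mem_of_mulEquiv (QuotientGroup.quotientKerEquivRange (f.prod g)).symm hD
  refine hX.image (QuotientGroup.lift (f.prod g).ker k ?_) ?_ hQ
  · intro x hx
    refine h ?_
    simpa [MonoidHom.mem_ker, Prod.ext_iff] using hx
  · exact QuotientGroup.lift_surjective_of_surjective _ _ hk _

theorem IsFormation.mem_of_ker_le (hX : X.IsFormation) {G A K : Type u} [Group G] [Group A]
    [Group K] (f : G →* A) (k : G →* K) (hf : Function.Surjective f) (hk : Function.Surjective k)
    (h : f.ker ≤ k.ker) (hA : X.Mem A) : X.Mem K :=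
  hX.mem_of_ker_inf_le f f k hf hf hk (inf_le_left.trans h) hA hA

theorem IsFormation.mem_quotient_residual (hX : X.IsFormation) (G : Type u) [Group G] [Finite G] :
    X.Mem (G ⧸ X.residual G) := by
  classical
  have hfin : {N : Subgroup G | ∃ _ : N.Normal, X.Mem (G ⧸ N)}.Finite := Set.toFinite _
  have key : ∃ _ : (hfin.toFinset.inf id).Normal, X.Mem (G ⧸ hfin.toFinset.inf id) := by
    refine Finset.inf_induction (p := fun N : Subgroup G => ∃ _ : N.Normal, X.Mem (G ⧸ N)) ?_ ?_ ?_
    · have := QuotientGroup.subsingleton_quotient_top (G := G)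
      exact ⟨inferInstance, hX.mem_of_subsingleton _⟩
    · rintro A ⟨hA, hXA⟩ B ⟨hB, hXB⟩
      refine ⟨inferInstance, hX.mem_of_ker_inf_le (QuotientGroup.mk' A) (QuotientGroup.mk' B)
        (QuotientGroup.mk' (A ⊓ B)) (QuotientGroup.mk'_surjective _)
        (QuotientGroup.mk'_surjective _) (QuotientGroup.mk'_surjective _) ?_ hXA hXB⟩
      simp
    · intro N hN
      exact hfin.mem_toFinset.1 hN
  have he : X.residual G = hfin.toFinset.inf id := by
    rw [residual, Finset.inf_id_eq_sInf, Set.Finite.coe_toFinset]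
  obtain ⟨h, h'⟩ := key
  exact X.mem_of_mulEquiv (QuotientGroup.quotientMulEquivOfEq he.symm) h'

theorem IsFormation.mem_iff_residual_le_ker (hX : X.IsFormation) {G K : Type u} [Group G]
    [Group K] [Finite G] (f : G →* K) (hf : Function.Surjective f) :
    X.Mem K ↔ X.residual G ≤ f.ker := by
  constructor
  · intro h
    exact sInf_le ⟨inferInstance,
      X.mem_of_mulEquiv (QuotientGroup.quotientKerEquivOfSurjective f hf).symm h⟩
  · intro h
    refine hX.mem_of_ker_le (QuotientGroup.mk' (X.residual G)) f
      (QuotientGroup.mk'_surjective _) hf ?_ (hX.mem_quotient_residual G)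
    rwa [QuotientGroup.ker_mk']

theorem IsFormation.residual_eq_bot_iff (hX : X.IsFormation) (G : Type u) [Group G] [Finite G] :
    X.residual G = ⊥ ↔ X.Mem G := by
  rw [hX.mem_iff_residual_le_ker (MonoidHom.id G) Function.surjective_id, MonoidHom.ker_id,
    le_bot_iff]

theorem IsFormation.map_residual_of_surjective (hX : X.IsFormation) {G K : Type u} [Group G]
    [Group K] [Finite G] (f : G →* K) (hf : Function.Surjective f) :
    (X.residual G).map f = X.residual K := by
  have : Finite K := Finite.of_surjective f hf
  apply le_antisymm
  · rw [Subgroup.map_le_iff_le_comap]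
    have h := (hX.mem_iff_residual_le_ker ((QuotientGroup.mk' (X.residual K)).comp f)
      ((QuotientGroup.mk'_surjective _).comp hf)).1 (hX.mem_quotient_residual K)
    rwa [← MonoidHom.comap_ker, QuotientGroup.ker_mk'] at h
  · have hn : ((X.residual G).map f).Normal := Subgroup.Normal.map inferInstance f hf
    have h := (hX.mem_iff_residual_le_ker ((QuotientGroup.mk' ((X.residual G).map f)).comp f)
      ((QuotientGroup.mk'_surjective _).comp hf)).2 (by
        rw [← MonoidHom.comap_ker, QuotientGroup.ker_mk']
        exact Subgroup.le_comap_map _ _)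
    have h' := (hX.mem_iff_residual_le_ker (QuotientGroup.mk' ((X.residual G).map f))
      (QuotientGroup.mk'_surjective _)).1 h
    rwa [QuotientGroup.ker_mk'] at h'

theorem mem_of_injective (hS : X = X.subgroupClosure) {A B : Type u} [Group A] [Group B]
    (f : A →* B) (hf : Function.Injective f) (hB : X.Mem B) : X.Mem A := by
  rw [hS]
  exact ⟨B, _, f, hB, hf⟩

theorem IsFormation.map_subtype_residual_le (hX : X.IsFormation) (hS : X = X.subgroupClosure)
    {G : Type u} [Group G] [Finite G] (H : Subgroup G) :
    (X.residual H).map H.subtype ≤ X.residual G := by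
  set f : H →* G ⧸ X.residual G := (QuotientGroup.mk' (X.residual G)).comp H.subtype with hf
  have h : X.Mem f.range :=
    mem_of_injective hS f.range.subtype f.range.subtype_injective (hX.mem_quotient_residual G)
  have h' := (hX.mem_iff_residual_le_ker f.rangeRestrict f.rangeRestrict_surjective).1 h
  rw [MonoidHom.ker_rangeRestrict, hf, ← MonoidHom.comap_ker, QuotientGroup.ker_mk'] at h'
  rwa [Subgroup.map_le_iff_le_comap]

theorem exists_critical_subgroup {G : Type u} [Group G] [Finite G] (hG : ¬ X.Mem G) :
    ∃ H : Subgroup G, X.critical.Mem H := by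
  have hne : {H : Subgroup G | ¬ X.Mem H}.Nonempty :=
    ⟨⊤, fun h => hG (X.mem_of_mulEquiv Subgroup.topEquiv h)⟩
  obtain ⟨H, hH, hmin⟩ := Set.Finite.exists_minimal (Set.toFinite _) hne
  refine ⟨H, inferInstance, hH, fun K hK => ?_⟩
  by_contra hK'
  have hle : K.map H.subtype ≤ H := Subgroup.map_subtype_le K
  have h := hmin (y := K.map H.subtype)
    (fun h => hK' (X.mem_of_mulEquiv (K.equivMapOfInjective _ H.subtype_injective).symm h)) hle
  apply hK
  rw [eq_top_iff]
  intro x _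
  obtain ⟨y, hy, hyx⟩ := h x.2
  rwa [← Subtype.ext hyx]

theorem isFormation_of_ker_inf_eq_bot (hone : X.Mem PUnit)
    (himage : ∀ {G K : Type u} [Group G] [Group K] (f : G →* K), Function.Surjective f →
      X.Mem G → X.Mem K)
    (hsub : ∀ {G A B : Type u} [Group G] [Group A] [Group B] [Finite G] (f : G →* A) (g : G →* B),
      Function.Surjective f → Function.Surjective g → f.ker ⊓ g.ker = ⊥ →
      X.Mem A → X.Mem B → X.Mem G) : X.IsFormation where
  nonempty := ⟨PUnit, inferInstance, hone⟩
  image := himage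
  subdirect {A B} _ _ D hfst hsnd hA hB := by
    have := X.finite_of_mem hA
    have := X.finite_of_mem hB
    refine hsub ((MonoidHom.fst A B).comp D.subtype) ((MonoidHom.snd A B).comp D.subtype) ?_ ?_
      ?_ hA hB
    · rwa [← MonoidHom.range_eq_top, MonoidHom.range_comp, Subgroup.range_subtype]
    · rwa [← MonoidHom.range_eq_top, MonoidHom.range_comp, Subgroup.range_subtype]
    · exact eq_bot_iff.2 fun x hx => Subtype.ext (Prod.ext hx.1 hx.2)

theorem ker_subgroupMap_inf_ker_subgroupMap {G A B : Type*} [Group G] [Group A] [Group B]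
    {f : G →* A} {g : G →* B} (h : f.ker ⊓ g.ker = ⊥) (H : Subgroup G) :
    (f.subgroupMap H).ker ⊓ (g.subgroupMap H).ker = ⊥ := by
  rw [Subgroup.ker_subgroupMap, Subgroup.ker_subgroupMap, Subgroup.subgroupOf, Subgroup.subgroupOf,
    ← Subgroup.comap_inf, h]
  exact Subgroup.bot_subgroupOf _

theorem isFormation_nilpotentGroups : nilpotentGroups.{u}.IsFormation := by
  refine isFormation_of_ker_inf_eq_bot ⟨inferInstance, inferInstance⟩ (fun f hf hG => ?_)
    fun f g _ _ hfg hA hB => ?_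
  · have := hG.1
    have := hG.2
    exact ⟨Finite.of_surjective f hf, Group.nilpotent_of_surjective f hf⟩
  · have := hA.2
    have := hB.2
    have hinj : Function.Injective (f.prod g) := by
      rwa [← MonoidHom.ker_eq_bot_iff, MonoidHom.ker_prod]
    exact ⟨inferInstance, Group.nilpotent_of_mulEquiv (MonoidHom.ofInjective hinj).symm⟩

theorem IsFormation.formationProduct (hX : X.IsFormation) (h𝔣 : 𝔣.IsFormation) :
    (X.formationProduct 𝔣).IsFormation := by
  refine isFormation_of_ker_inf_eq_bot ⟨inferInstance, hX.mem_of_subsingleton _⟩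
    (fun f hf hG => ?_) fun {G A B} _ _ _ _ f g hf hg hfg hA hB => ⟨inferInstance, ?_⟩
  · have := hG.1
    refine ⟨Finite.of_surjective f hf, ?_⟩
    rw [← h𝔣.map_residual_of_surjective f hf]
    exact hX.image _ (f.subgroupMap_surjective _) hG.2
  · have hA' := hA.2
    have hB' := hB.2
    rw [← h𝔣.map_residual_of_surjective f hf] at hA'
    rw [← h𝔣.map_residual_of_surjective g hg] at hB'
    refine hX.mem_of_ker_inf_le (f.subgroupMap _) (g.subgroupMap _) (MonoidHom.id _)
      (f.subgroupMap_surjective _) (g.subgroupMap_surjective _) Function.surjective_id ?_ hA' hB'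
    rw [ker_subgroupMap_inf_ker_subgroupMap hfg]
    exact bot_le

/-! ### Fitting classes -/

theorem IsFittingClass.mem_of_le (hX : X.IsFittingClass) {G : Type u} [Group G] {N M : Subgroup G}
    (hN : N.Normal) (hle : N ≤ M) (hM : X.Mem M) : X.Mem N :=
  X.mem_of_mulEquiv (Subgroup.subgroupOfEquivOfLe hle)
    (hX.normal (N.subgroupOf M) (hN.subgroupOf M) hM)

theorem IsFittingClass.mem_of_subsingleton (hX : X.IsFittingClass) (G : Type u) [Group G]
    [Subsingleton G] : X.Mem G := by
  obtain ⟨A, _, hA⟩ := hX.nonempty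
  have : Unique G := ⟨⟨1⟩, fun _ => Subsingleton.elim _ _⟩
  exact X.mem_of_mulEquiv MulEquiv.ofUnique (hX.normal (⊥ : Subgroup A) inferInstance hA)

theorem IsFittingClass.radical_mem (hX : X.IsFittingClass) (G : Type u) [Group G] [Finite G] :
    X.Mem (X.radical G) := by
  classical
  have hfin : {N : Subgroup G | N.Normal ∧ X.Mem N}.Finite := Set.toFinite _
  have hsup : (hfin.toFinset.sup id).Normal ∧ X.Mem (hfin.toFinset.sup id : Subgroup G) := by
    refine Finset.sup_induction (p := fun N : Subgroup G => N.Normal ∧ X.Mem N)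
      ⟨inferInstance, hX.mem_of_subsingleton _⟩ ?_ fun N hN => hfin.mem_toFinset.1 hN
    rintro A ⟨hA, hXA⟩ B ⟨hB, hXB⟩
    exact ⟨inferInstance, hX.sup A B hA hB hXA hXB⟩
  rw [radical, ← hfin.coe_toFinset, ← Finset.sup_id_eq_sSup]
  exact hsup.2

theorem le_radical {G : Type u} [Group G] {N : Subgroup G} (hN : N.Normal) (h : X.Mem N) :
    N ≤ X.radical G :=
  le_sSup ⟨hN, h⟩

theorem radical_ne_bot_of_mem {G : Type u} [Group G] {N : Subgroup G} (hN : N.Normal)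
    (hne : N ≠ ⊥) (h : X.Mem N) : X.radical G ≠ ⊥ :=
  ne_bot_of_le_ne_bot hne (le_radical hN h)

theorem IsFittingClass.radical_ne_bot_of_normal (hX : X.IsFittingClass) {G : Type u} [Group G]
    [Finite G] {N : Subgroup G} (hN : N.Normal) (h : X.radical N ≠ ⊥) : X.radical G ≠ ⊥ := by
  refine radical_ne_bot_of_mem (N := (X.radical N).map N.subtype) inferInstance ?_
    (X.mem_of_mulEquiv ((X.radical N).equivMapOfInjective _ N.subtype_injective) (hX.radical_mem N))
  rwa [Ne, Subgroup.map_eq_bot_iff_of_injective _ N.subtype_injective]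

theorem map_radical_le_of_surjective (hF : X.IsFormation) (hX : X.IsFittingClass) {G K : Type u}
    [Group G] [Group K] [Finite G] (f : G →* K) (hf : Function.Surjective f) :
    (X.radical G).map f ≤ X.radical K :=
  le_radical (Subgroup.Normal.map inferInstance f hf)
    (hF.image (f.subgroupMap _) (f.subgroupMap_surjective _) (hX.radical_mem G))

theorem mem_of_extension (hE : X = X.extensionClosure) {G : Type u} [Group G] [Finite G]
    (N : Subgroup G) [N.Normal] (hN : X.Mem N) (hQ : X.Mem (G ⧸ N)) : X.Mem G := by
  rw [hE]
  let s : ℕ → Subgroup G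
    | 0 => ⊥
    | 1 => N
    | _ => ⊤
  refine ⟨inferInstance, 2, s, rfl, rfl, fun i hi => ?_⟩
  interval_cases i
  · change (⊥ : Subgroup G) ≤ N ∧ ∃ _ : ((⊥ : Subgroup G).subgroupOf N).Normal,
      X.Mem (N ⧸ (⊥ : Subgroup G).subgroupOf N)
    exact ⟨bot_le, inferInstance, X.mem_of_mulEquiv (QuotientGroup.quotientBot.symm.trans
      (QuotientGroup.quotientMulEquivOfEq (Subgroup.bot_subgroupOf N).symm)) hN⟩
  · change N ≤ ⊤ ∧ ∃ _ : (N.subgroupOf ⊤).Normal, X.Mem ((⊤ : Subgroup G) ⧸ N.subgroupOf ⊤)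
    exact ⟨le_top, inferInstance, X.mem_of_mulEquiv (QuotientGroup.congr N (N.subgroupOf ⊤)
      Subgroup.topEquiv.symm (Subgroup.map_equiv_eq_comap_symm Subgroup.topEquiv.symm N)) hQ⟩

theorem mem_of_ker_mem (hE : X = X.extensionClosure) {G K : Type u} [Group G] [Group K] [Finite G]
    (f : G →* K) (hf : Function.Surjective f) (hker : X.Mem f.ker) (hK : X.Mem K) : X.Mem G :=
  mem_of_extension hE f.ker hker
    (X.mem_of_mulEquiv (QuotientGroup.quotientKerEquivOfSurjective f hf).symm hK)

theorem extensionClosure_image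
    (hX : ∀ {G K : Type u} [Group G] [Group K] (f : G →* K), Function.Surjective f →
      X.Mem G → X.Mem K) {G K : Type u} [Group G] [Group K] (f : G →* K)
    (hf : Function.Surjective f) (hG : X.extensionClosure.Mem G) : X.extensionClosure.Mem K := by
  obtain ⟨_, n, s, hzero, hn, hs⟩ := hG
  refine ⟨Finite.of_surjective f hf, n, fun i => (s i).map f, by simp [hzero], ?_, fun i hi => ?_⟩
  · simp only [hn]
    exact Subgroup.map_top_of_surjective f hf
  obtain ⟨hle, hnor, hmem⟩ := hs i hi
  have hmap : ((s i).subgroupOf (s (i + 1))).map (f.subgroupMap (s (i + 1))) =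
      ((s i).map f).subgroupOf ((s (i + 1)).map f) := by
    ext ⟨y, hy⟩
    simp only [Subgroup.mem_map, Subgroup.mem_subgroupOf]
    constructor
    · rintro ⟨x, hx, hxy⟩
      exact ⟨x, hx, congrArg Subtype.val hxy⟩
    · rintro ⟨x, hx, hxy⟩
      exact ⟨⟨x, hle hx⟩, hx, Subtype.ext hxy⟩
  have hnor' : (((s i).map f).subgroupOf ((s (i + 1)).map f)).Normal := by
    rw [← hmap]
    exact hnor.map _ (f.subgroupMap_surjective _)
  refine ⟨Subgroup.map_mono hle, hnor', hX (QuotientGroup.map _ _ (f.subgroupMap (s (i + 1)))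
    (Subgroup.map_le_iff_le_comap.1 hmap.le)) ?_ hmem⟩
  exact QuotientGroup.map_surjective_of_surjective _ _ _
    ((QuotientGroup.mk'_surjective _).comp (f.subgroupMap_surjective _)) _

/-! ### Products with a Fitting class -/

theorem IsFormation.mem_fittingProduct_of_surjective (hX : X.IsFormation) {G K : Type u} [Group G]
    [Group K] [Finite G] (f : G →* K) (hf : Function.Surjective f) (hker : 𝔥.Mem f.ker)
    (hK : X.Mem K) : (𝔥.fittingProduct X).Mem G := by
  refine ⟨inferInstance, hX.mem_of_ker_le f (QuotientGroup.mk' (𝔥.radical G)) hf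
    (QuotientGroup.mk'_surjective _) ?_ hK⟩
  rw [QuotientGroup.ker_mk']
  exact le_radical inferInstance hker

theorem IsFormation.le_fittingProduct (hX : X.IsFormation) : X ≤ 𝔥.fittingProduct X :=
  fun _ _ hG => ⟨X.finite_of_mem hG, hX.image _ (QuotientGroup.mk'_surjective _) hG⟩

theorem mem_of_mem_fittingProduct_of_radical_eq_bot {G : Type u} [Group G]
    (hrad : 𝔥.radical G = ⊥) (hG : (𝔥.fittingProduct X).Mem G) : X.Mem G :=
  X.mem_of_mulEquiv ((QuotientGroup.quotientMulEquivOfEq hrad).trans QuotientGroup.quotientBot) hG.2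

theorem mem_fittingProduct_of_extension (h𝔥 : 𝔥.IsFittingClass) (hE : 𝔥 = 𝔥.extensionClosure)
    (hX : X.IsFormation) {G : Type u} [Group G] [Finite G] (N : Subgroup G) [N.Normal]
    (hN : 𝔥.Mem N) (hQ : (𝔥.fittingProduct X).Mem (G ⧸ N)) : (𝔥.fittingProduct X).Mem G := by
  set R := (𝔥.radical (G ⧸ N)).comap (QuotientGroup.mk' N) with hR
  have hNR : N ≤ R := (QuotientGroup.ker_mk' N).ge.trans (MonoidHom.ker_le_comap _ _)
  refine hX.mem_fittingProduct_of_surjective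
    ((QuotientGroup.mk' (𝔥.radical (G ⧸ N))).comp (QuotientGroup.mk' N))
    ((QuotientGroup.mk'_surjective _).comp (QuotientGroup.mk'_surjective _)) ?_ hQ.2
  rw [← MonoidHom.comap_ker, QuotientGroup.ker_mk', ← hR]
  refine mem_of_ker_mem hE ((QuotientGroup.mk' N).subgroupMap R)
    ((QuotientGroup.mk' N).subgroupMap_surjective R) ?_ ?_
  · rw [Subgroup.ker_subgroupMap, QuotientGroup.ker_mk']
    exact 𝔥.mem_of_mulEquiv (Subgroup.subgroupOfEquivOfLe hNR).symm hN
  · rw [hR, Subgroup.map_comap_eq_self_of_surjective (QuotientGroup.mk'_surjective N)]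
    exact h𝔥.radical_mem _

theorem IsFormation.fittingProduct (h𝔥F : 𝔥.IsFormation) (h𝔥 : 𝔥.IsFittingClass)
    (hX : X.IsFormation) : (𝔥.fittingProduct X).IsFormation := by
  refine isFormation_of_ker_inf_eq_bot (hX.le_fittingProduct _ (hX.mem_of_subsingleton _))
    (fun {G K} _ _ f hf hG => ?_) fun {G A B} _ _ _ _ f g hf hg hfg hA hB => ?_
  · have := hG.1
    refine ⟨Finite.of_surjective f hf, hX.image (QuotientGroup.map (𝔥.radical G) (𝔥.radical K) f
      (Subgroup.map_le_iff_le_comap.1 (map_radical_le_of_surjective h𝔥F h𝔥 f hf))) ?_ hG.2⟩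
    exact QuotientGroup.map_surjective_of_surjective _ _ _
      ((QuotientGroup.mk'_surjective _).comp hf) _
  · let f' := (QuotientGroup.mk' (𝔥.radical A)).comp f
    let g' := (QuotientGroup.mk' (𝔥.radical B)).comp g
    have hRA : (f'.ker ⊓ g'.ker).map f ≤ 𝔥.radical A := by
      rw [Subgroup.map_le_iff_le_comap, ← MonoidHom.comap_ker, QuotientGroup.ker_mk']
      exact inf_le_left
    have hRB : (f'.ker ⊓ g'.ker).map g ≤ 𝔥.radical B := by
      rw [Subgroup.map_le_iff_le_comap, ← MonoidHom.comap_ker _ g, QuotientGroup.ker_mk']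
      exact inf_le_right
    have := Finite.of_surjective f hf
    have := Finite.of_surjective g hg
    have hR : 𝔥.Mem (f'.ker ⊓ g'.ker : Subgroup G) := by
      refine h𝔥F.mem_of_ker_inf_le (f.subgroupMap _) (g.subgroupMap _) (MonoidHom.id _)
        (f.subgroupMap_surjective _) (g.subgroupMap_surjective _) Function.surjective_id
        ((ker_subgroupMap_inf_ker_subgroupMap hfg _).trans_le bot_le)
        (h𝔥.mem_of_le (Subgroup.Normal.map inferInstance f hf) hRA (h𝔥.radical_mem A))
        (h𝔥.mem_of_le (Subgroup.Normal.map inferInstance g hg) hRB (h𝔥.radical_mem B))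
    rw [← QuotientGroup.ker_mk' (f'.ker ⊓ g'.ker)] at hR
    refine hX.mem_fittingProduct_of_surjective _ (QuotientGroup.mk'_surjective _) hR
      (hX.mem_of_ker_inf_le f' g' _ ((QuotientGroup.mk'_surjective _).comp hf)
        ((QuotientGroup.mk'_surjective _).comp hg) (QuotientGroup.mk'_surjective _) ?_ hA.2 hB.2)
    rw [QuotientGroup.ker_mk']

/-! ### Groups of prime power order -/

theorem exists_normal_card_eq_of_isPGroup {P : Type*} [Group P] [Finite P] [Nontrivial P] {q : ℕ}
    [Fact q.Prime] (hP : IsPGroup q P) : ∃ Z : Subgroup P, Z.Normal ∧ Nat.card Z = q := by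
  have := hP.center_nontrivial
  have hdvd := (hP.to_subgroup (Subgroup.center P)).card_eq_or_dvd
  obtain ⟨z, hz⟩ := exists_prime_orderOf_dvd_card' (G := Subgroup.center P) q
    (hdvd.resolve_left Finite.one_lt_card.ne')
  refine ⟨Subgroup.zpowers (z : P), ⟨fun n hn g => ?_⟩, ?_⟩
  · have hcenter : n ∈ Subgroup.center P := Subgroup.zpowers_le.2 z.2 hn
    rwa [Subgroup.mem_center_iff.1 hcenter g, mul_inv_cancel_right]
  · rw [Nat.card_zpowers, Subgroup.orderOf_coe, hz]

/-- The kernel of the cover `U → L` is a `q`-group by the choice of the exponent, and it is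
nontrivial because an element of order `q` of `L` has no lift of order `q`. -/
theorem exists_nontrivial_isPGroup_mem (hF : X.IsFormation) (hX : X.IsFittingClass)
    (hsat : X.IsSaturated) {L : Type u} [Group L] (hL : X.Mem L) {q : ℕ} [hq : Fact q.Prime]
    (hdvd : q ∣ Nat.card L) :
    ∃ (B : Type u) (_ : Group B), Nontrivial B ∧ X.Mem B ∧ IsPGroup q B := by
  have : Finite L := X.finite_of_mem hL
  obtain ⟨x, hx⟩ := exists_prime_orderOf_dvd_card' q hdvd
  obtain ⟨E, _, _, f, hf, hpow⟩ := exists_surjective_pow_eq_one_iff L hq.out.ne_zero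
  obtain ⟨U, hU, hfrattini⟩ := exists_subgroup_ker_le_frattini f hf
  have hUX : X.Mem U := by
    refine hsat U (hF.mem_of_ker_le (f.comp U.subtype) (QuotientGroup.mk' (frattini U)) hU
      (QuotientGroup.mk'_surjective _) ?_ hL)
    rwa [QuotientGroup.ker_mk']
  obtain ⟨u, hu⟩ := hU x
  refine ⟨(f.comp U.subtype).ker, inferInstance, ?_, hX.normal _ inferInstance hUX, ?_⟩
  · rw [Subgroup.nontrivial_iff_exists_ne_one]
    refine ⟨u ^ q, ?_, fun h => ?_⟩
    · rw [MonoidHom.mem_ker, map_pow, hu, ← hx, pow_orderOf_eq_one]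
    · have hfu : f u = 1 := (hpow u).1 (by simpa using congrArg Subtype.val h)
      rw [← hu, MonoidHom.comp_apply, Subgroup.coe_subtype, hfu, orderOf_one] at hx
      exact hq.out.ne_one hx.symm
  · rintro ⟨y, hy⟩
    refine ⟨1, Subtype.ext (Subtype.ext ?_)⟩
    simpa using (hpow y).2 hy

theorem radical_ne_bot_of_isPGroup (hF : X.IsFormation) (hX : X.IsFittingClass)
    (hsat : X.IsSaturated) {L : Type u} [Group L] (hL : X.Mem L) {q : ℕ} [hq : Fact q.Prime]
    (hdvd : q ∣ Nat.card L) {P : Type u} [Group P] [Finite P] [Nontrivial P] (hP : IsPGroup q P) :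
    X.radical P ≠ ⊥ := by
  obtain ⟨B, _, _, hBX, hB⟩ := exists_nontrivial_isPGroup_mem hF hX hsat hL hdvd
  have := X.finite_of_mem hBX
  obtain ⟨Z, hZ, hcardZ⟩ := exists_normal_card_eq_of_isPGroup hB
  obtain ⟨W, hW, hcardW⟩ := exists_normal_card_eq_of_isPGroup hP
  have : IsCyclic W := isCyclic_of_prime_card hcardW
  have : IsCyclic Z := isCyclic_of_prime_card hcardZ
  refine radical_ne_bot_of_mem hW ?_ (X.mem_of_mulEquiv
    (mulEquivOfCyclicCardEq (hcardZ.trans hcardW.symm)) (hX.normal Z hZ hBX))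
  exact (Subgroup.one_lt_card_iff_ne_bot W).1 (hcardW ▸ hq.out.one_lt)

/-! ### Normal `π'`-subgroups and normal subgroups of prime power order -/

theorem isFittingClass_piGroups (π : Set Nat.Primes) : (piGroups.{u} π).IsFittingClass where
  nonempty := ⟨PUnit, inferInstance, inferInstance, fun p hp => by
    rw [Nat.card_unique, Nat.dvd_one] at hp
    exact absurd hp p.2.ne_one⟩
  normal N _ h := by
    have := h.1
    exact ⟨inferInstance, fun p hp => h.2 p (hp.trans N.card_subgroup_dvd_card)⟩
  sup M N _ _ hπM hπN := by
    refine ⟨inferInstance, fun p hp => ?_⟩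
    have hcard : Nat.card (M ⊔ N : Subgroup _) ∣ Nat.card M * Nat.card N := by
      rw [← Subgroup.card_mul_index (N.subgroupOf (M ⊔ N)), mul_comm,
        Nat.card_congr (Subgroup.subgroupOfEquivOfLe le_sup_right).toEquiv]
      refine mul_dvd_mul_right ?_ _
      change N.relIndex (M ⊔ N) ∣ _
      rw [Subgroup.relIndex_sup_right]
      exact (N.subgroupOf M).index_dvd_card
    exact (p.2.dvd_mul.1 (hp.trans hcard)).elim (hπM.2 p) (hπN.2 p)

theorem piGroups_singleton_mem_iff (q : Nat.Primes) (G : Type u) [Group G] [Finite G] :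
    (piGroups {q}).Mem G ↔ IsPGroup (q : ℕ) G := by
  have : Fact (q : ℕ).Prime := ⟨q.2⟩
  rw [IsPGroup.iff_card]
  constructor
  · rintro ⟨_, h⟩
    refine ⟨_, Nat.eq_prime_pow_of_unique_prime_dvd Nat.card_pos.ne' fun {d} hd hdvd => ?_⟩
    exact congrArg Subtype.val (Set.mem_singleton_iff.1 (h ⟨d, hd⟩ hdvd))
  · rintro ⟨n, hn⟩
    refine ⟨inferInstance, fun p hp => ?_⟩
    rw [hn] at hp
    exact Subtype.ext ((Nat.prime_dvd_prime_iff_eq p.2 q.2).1 (p.2.dvd_of_dvd_pow hp))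

/-- The group has a nontrivial normal `π'`-subgroup or a nontrivial normal `q`-subgroup for some
prime `q`: what `π`-solvable and `π`-nilpotent groups have in common. -/
def HasLocalRadical (π : Set Nat.Primes) (G : Type u) [Group G] : Prop :=
  (piGroups πᶜ).radical G ≠ ⊥ ∨ ∃ q : Nat.Primes, (piGroups {q}).radical G ≠ ⊥

theorem HasLocalRadical.of_normal {G : Type u} [Group G] [Finite G] {N : Subgroup G}
    (hN : N.Normal) (h : HasLocalRadical π N) : HasLocalRadical π G :=
  h.imp (fun h => (isFittingClass_piGroups _).radical_ne_bot_of_normal hN h)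
    fun ⟨q, h⟩ => ⟨q, (isFittingClass_piGroups _).radical_ne_bot_of_normal hN h⟩

theorem HasLocalRadical.of_mulEquiv {G K : Type u} [Group G] [Group K] (e : G ≃* K)
    (h : HasLocalRadical π G) : HasLocalRadical π K := by
  have hne (X : GroupClass.{u}) (hX : X.radical G ≠ ⊥) : X.radical K ≠ ⊥ := by
    rwa [← X.map_radical e, Ne, Subgroup.map_eq_bot_iff_of_injective _ e.injective]
  exact h.imp (hne _) fun ⟨q, h⟩ => ⟨q, hne _ h⟩

theorem hasLocalRadical_of_mem_piSolvableFactors {G : Type u} [Group G] [Nontrivial G]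
    (h : (piSolvableFactors π).Mem G) : HasLocalRadical π G := by
  have := h.1
  rcases h.2 with h | ⟨q, _, h⟩
  · exact Or.inl (radical_ne_bot_of_mem (N := ⊤) inferInstance top_ne_bot
      (GroupClass.mem_of_mulEquiv _ Subgroup.topEquiv.symm h))
  · exact Or.inr ⟨q, radical_ne_bot_of_mem (N := ⊤) inferInstance top_ne_bot
      ((piGroups_singleton_mem_iff q _).2 (h.of_equiv Subgroup.topEquiv.symm))⟩

theorem hasLocalRadical_of_isNilpotent {G : Type u} [Group G] [Finite G] [Nontrivial G]
    (h : Group.IsNilpotent G) : HasLocalRadical π G := by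
  have hq : (Nat.card G).minFac.Prime := Nat.minFac_prime Finite.one_lt_card.ne'
  have : Fact (Nat.card G).minFac.Prime := ⟨hq⟩
  obtain ⟨P⟩ : Nonempty (Sylow (Nat.card G).minFac G) := inferInstance
  refine Or.inr ⟨⟨_, hq⟩, radical_ne_bot_of_mem (N := P)
    (isNilpotent_iff_forall_sylow_normal.1 h _ inferInstance P)
    (P.ne_bot_of_dvd_card (Nat.minFac_dvd _)) ?_⟩
  exact (piGroups_singleton_mem_iff ⟨_, hq⟩ _).2 P.2

theorem hasLocalRadical_of_mem_piNilpotentGroups {G : Type u} [Group G] [Nontrivial G]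
    (h : (piNilpotentGroups π).Mem G) : HasLocalRadical π G := by
  obtain ⟨_, N, hN, hπ, hnil⟩ := h
  by_cases hne : N = ⊥
  · subst hne
    exact hasLocalRadical_of_isNilpotent (Group.nilpotent_of_mulEquiv QuotientGroup.quotientBot)
  · exact Or.inl (radical_ne_bot_of_mem hN hne hπ)

theorem hasLocalRadical_of_mem_piSolvableGroups {G : Type u} [Group G] [Nontrivial G]
    (h : (piSolvableGroups π).Mem G) : HasLocalRadical π G := by
  obtain ⟨_, n, s, hzero, hn, hs⟩ := h
  have hterm : ∀ j ≤ n, s j ≠ ⊥ → HasLocalRadical π (s j) := by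
    intro j
    induction j with
    | zero => exact fun _ h => absurd hzero h
    | succ j ih =>
      intro hj hne
      obtain ⟨hle, hnormal, hfactor⟩ := hs j hj
      by_cases hbot : s j = ⊥
      · have : Nontrivial (s (j + 1)) := (Subgroup.nontrivial_iff_ne_bot _).2 hne
        refine hasLocalRadical_of_mem_piSolvableFactors ((piSolvableFactors π).mem_of_mulEquiv
          ((QuotientGroup.quotientMulEquivOfEq ?_).trans QuotientGroup.quotientBot) hfactor)
        rw [hbot, Subgroup.bot_subgroupOf]
      · exact ((ih (by lia) hbot).of_mulEquiv (Subgroup.subgroupOfEquivOfLe hle).symm).of_normal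
          hnormal
  have htop := hterm n le_rfl (hn ▸ top_ne_bot)
  rw [hn] at htop
  exact htop.of_mulEquiv Subgroup.topEquiv

theorem piSolvableGroups_image {G K : Type u} [Group G] [Group K] (f : G →* K)
    (hf : Function.Surjective f) (hG : (piSolvableGroups π).Mem G) :
    (piSolvableGroups π).Mem K := by
  refine extensionClosure_image (fun {A B} _ _ g hg hA => ?_) f hf hG
  have := hA.1
  have : Finite B := Finite.of_surjective g hg
  refine ⟨inferInstance, hA.2.imp ?_ ?_⟩
  · exact fun h => ⟨inferInstance,
      fun p hp => h.2 p (hp.trans (Subgroup.card_dvd_of_surjective g hg))⟩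
  · exact fun ⟨p, hp, h⟩ => ⟨p, hp, h.of_surjective g hg⟩

theorem isFormation_fittingNilpotentProduct (h𝔥F : 𝔥.IsFormation) (h𝔥 : 𝔥.IsFittingClass)
    (h𝔣 : 𝔣.IsFormation) : (fittingNilpotentProduct 𝔥 𝔣).IsFormation :=
  h𝔥F.fittingProduct h𝔥 (isFormation_nilpotentGroups.formationProduct h𝔣)

theorem mem_fittingNilpotentProduct_of_isNilpotent_residual (h𝔣 : 𝔣.IsFormation) {G : Type u}
    [Group G] [Finite G] (h : Group.IsNilpotent (𝔣.residual G)) :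
    (fittingNilpotentProduct 𝔥 𝔣).Mem G :=
  (isFormation_nilpotentGroups.formationProduct h𝔣).le_fittingProduct _
    ⟨inferInstance, inferInstance, h⟩

theorem isNilpotent_residual_of_radical_eq_bot {G : Type u} [Group G] (hrad : 𝔥.radical G = ⊥)
    (h : (fittingNilpotentProduct 𝔥 𝔣).Mem G) : Group.IsNilpotent (𝔣.residual G) :=
  (mem_of_mem_fittingProduct_of_radical_eq_bot hrad h).2.2

/-! ### The norm -/

theorem IsFormation.map_residual_comap_subtype (h𝔣 : 𝔣.IsFormation) {G K : Type u} [Group G]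
    [Group K] [Finite G] (f : G →* K) (hf : Function.Surjective f) (H : Subgroup K) :
    ((𝔣.residual (H.comap f)).map (H.comap f).subtype).map f =
      (𝔣.residual H).map H.subtype := by
  rw [← h𝔣.map_residual_of_surjective (f.subgroupComap H)
    (f.subgroupComap_surjective_of_surjective H hf), Subgroup.map_map, Subgroup.map_map]
  rfl

theorem map_norm_le (h𝔥F : 𝔥.IsFormation) (h𝔥 : 𝔥.IsFittingClass) (h𝔣 : 𝔣.IsFormation)
    {G K : Type u} [Group G] [Group K] [Finite G] (f : G →* K) (hf : Function.Surjective f) :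
    (norm 𝔥 𝔣 G).map f ≤ norm 𝔥 𝔣 K := by
  refine le_iInf fun H => ?_
  rintro _ ⟨x, hx, rfl⟩
  have hmap : f x ∈ Subgroup.normalizer
      (((𝔣.residual H).map H.subtype ⊔ (𝔥.radical G).map f : Subgroup K) : Set K) := by
    rw [← h𝔣.map_residual_comap_subtype f hf, ← Subgroup.map_sup]
    exact Subgroup.le_normalizer_map f ⟨x, Subgroup.mem_iInf.1 hx (H.comap f), rfl⟩
  have hsup : (𝔣.residual H).map H.subtype ⊔ 𝔥.radical K =
      ((𝔣.residual H).map H.subtype ⊔ (𝔥.radical G).map f) ⊔ 𝔥.radical K := by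
    rw [sup_assoc, sup_eq_right.2 (map_radical_le_of_surjective h𝔥F h𝔥 f hf)]
  rw [hsup]
  refine Subgroup.normalizer_inf_normalizer_le_normalizer_sup _ _ ⟨hmap, ?_⟩
  rw [Subgroup.normalizer_eq_top]
  exact Subgroup.mem_top _

theorem norm_le_ker (h𝔥F : 𝔥.IsFormation) (h𝔥 : 𝔥.IsFittingClass) (h𝔣 : 𝔣.IsFormation)
    {G K : Type u} [Group G] [Group K] [Finite G] (f : G →* K) (hf : Function.Surjective f)
    (hK : norm 𝔥 𝔣 K = ⊥) : norm 𝔥 𝔣 G ≤ f.ker :=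
  (Subgroup.map_eq_bot_iff _).1 (le_bot_iff.1 (hK ▸ map_norm_le h𝔥F h𝔥 h𝔣 f hf))

theorem radical_le_norm (G : Type u) [Group G] : 𝔥.radical G ≤ norm 𝔥 𝔣 G :=
  le_iInf fun _ => le_sup_right.trans Subgroup.le_normalizer

theorem norm_le_normalizer_of_radical_eq_bot {G : Type u} [Group G] (hrad : 𝔥.radical G = ⊥)
    (H : Subgroup G) :
    norm 𝔥 𝔣 G ≤ Subgroup.normalizer ((𝔣.residual H).map H.subtype : Set G) := by
  refine (iInf_le _ H).trans ?_
  rw [hrad, sup_bot_eq]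

theorem centralizer_residual_le_norm (h𝔣 : 𝔣.IsFormation) (hS : 𝔣 = 𝔣.subgroupClosure)
    {G : Type u} [Group G] [Finite G] (hrad : 𝔥.radical G = ⊥) :
    Subgroup.centralizer (𝔣.residual G : Set G) ≤ norm 𝔥 𝔣 G := by
  refine le_iInf fun H => ?_
  rw [hrad, sup_bot_eq]
  exact (Subgroup.centralizer_le (h𝔣.map_subtype_residual_le hS H)).trans
    (Subgroup.centralizer_le_normalizer _)

theorem centralizer_ne_bot_of_isNilpotent {G : Type*} [Group G] [Nontrivial G] (H : Subgroup G)
    [Group.IsNilpotent H] : Subgroup.centralizer (H : Set G) ≠ ⊥ := by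
  rcases eq_or_ne H ⊥ with rfl | hne
  · have htop : Subgroup.centralizer ((⊥ : Subgroup G) : Set G) = ⊤ := by
      rw [Subgroup.centralizer_eq_top_iff_subset]
      exact (bot_le : ⊥ ≤ Subgroup.center G)
    exact htop ▸ top_ne_bot
  · have : Nontrivial H := (Subgroup.nontrivial_iff_ne_bot _).2 hne
    have hcenter : (Subgroup.center H).map H.subtype ≠ ⊥ := by
      rw [Ne, Subgroup.map_eq_bot_iff_of_injective _ H.subtype_injective]
      exact Group.IsNilpotent.center_ne_bot _
    refine ne_bot_of_le_ne_bot hcenter ?_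
    rintro _ ⟨z, hz, rfl⟩
    exact Subgroup.mem_centralizer_iff.2 fun y hy =>
      congrArg Subtype.val (Subgroup.mem_center_iff.1 hz ⟨y, hy⟩)

theorem norm_ne_bot (h𝔣 : 𝔣.IsFormation) (hS : 𝔣 = 𝔣.subgroupClosure) {G : Type u} [Group G]
    [Finite G] [Nontrivial G] (h : (fittingNilpotentProduct 𝔥 𝔣).Mem G) : norm 𝔥 𝔣 G ≠ ⊥ := by
  by_cases hrad : 𝔥.radical G = ⊥
  · have := isNilpotent_residual_of_radical_eq_bot hrad h
    exact ne_bot_of_le_ne_bot (centralizer_ne_bot_of_isNilpotent (𝔣.residual G))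
      (centralizer_residual_le_norm h𝔣 hS hrad)
  · exact ne_bot_of_le_ne_bot hrad (radical_le_norm G)

/-! ### The norm series -/

theorem normSeries_succ (𝔥 𝔣 : GroupClass.{u}) (G : Type u) [Group G] (i : ℕ) :
    normSeries 𝔥 𝔣 G (i + 1) = (norm 𝔥 𝔣 (G ⧸ normSeries 𝔥 𝔣 G i)).comap
      (QuotientGroup.mk' (normSeries 𝔥 𝔣 G i)) :=
  rfl

theorem normSeries_mono (𝔥 𝔣 : GroupClass.{u}) (G : Type u) [Group G] :
    Monotone (normSeries 𝔥 𝔣 G) :=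
  monotone_nat_of_le_succ fun _ =>
    (QuotientGroup.ker_mk' _).ge.trans (MonoidHom.ker_le_comap _ _)

theorem exists_normInfty_eq_normSeries (𝔥 𝔣 : GroupClass.{u}) (G : Type u) [Group G] [Finite G] :
    ∃ n, normInfty 𝔥 𝔣 G = normSeries 𝔥 𝔣 G n := by
  obtain ⟨n, hn⟩ :=
    WellFoundedGT.monotone_chain_condition ⟨normSeries 𝔥 𝔣 G, normSeries_mono 𝔥 𝔣 G⟩
  refine ⟨n, le_antisymm (iSup_le fun m => ?_) (le_iSup _ n)⟩
  exact (le_total n m).elim (fun h => (hn m h).ge) fun h => normSeries_mono 𝔥 𝔣 G h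

theorem norm_quotient_normInfty (𝔥 𝔣 : GroupClass.{u}) (G : Type u) [Group G] [Finite G] :
    norm 𝔥 𝔣 (G ⧸ normInfty 𝔥 𝔣 G) = ⊥ := by
  obtain ⟨n, hn⟩ := exists_normInfty_eq_normSeries 𝔥 𝔣 G
  have hnext : normSeries 𝔥 𝔣 G (n + 1) ≤ normSeries 𝔥 𝔣 G n :=
    hn ▸ le_iSup (normSeries 𝔥 𝔣 G) (n + 1)
  suffices ∀ (N : Subgroup G) (_ : N.Normal), N = normSeries 𝔥 𝔣 G n → norm 𝔥 𝔣 (G ⧸ N) = ⊥ from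
    this _ inferInstance hn
  rintro N _ rfl
  rw [← Subgroup.map_comap_eq_self_of_surjective (QuotientGroup.mk'_surjective
    (normSeries 𝔥 𝔣 G n)) (norm 𝔥 𝔣 (G ⧸ normSeries 𝔥 𝔣 G n)), Subgroup.map_eq_bot_iff,
    QuotientGroup.ker_mk', ← normSeries_succ]
  exact hnext

theorem normInfty_le_of_norm_quotient_eq_bot (h𝔥F : 𝔥.IsFormation) (h𝔥 : 𝔥.IsFittingClass)
    (h𝔣 : 𝔣.IsFormation) {G : Type u} [Group G] [Finite G] {N : Subgroup G} [N.Normal]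
    (hN : norm 𝔥 𝔣 (G ⧸ N) = ⊥) : normInfty 𝔥 𝔣 G ≤ N := by
  refine iSup_le fun i => ?_
  induction i with
  | zero => exact bot_le
  | succ i ih =>
    have hker := norm_le_ker h𝔥F h𝔥 h𝔣
      (QuotientGroup.map (normSeries 𝔥 𝔣 G i) N (MonoidHom.id G) ih)
      (QuotientGroup.map_surjective_of_surjective _ N (MonoidHom.id G)
        (QuotientGroup.mk'_surjective N) ih) hN
    intro x hx
    exact (QuotientGroup.eq_one_iff x).1 (hker hx)

theorem norm_le_normInfty (h𝔥F : 𝔥.IsFormation) (h𝔥 : 𝔥.IsFittingClass) (h𝔣 : 𝔣.IsFormation)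
    (G : Type u) [Group G] [Finite G] : norm 𝔥 𝔣 G ≤ normInfty 𝔥 𝔣 G := by
  have hker := norm_le_ker h𝔥F h𝔥 h𝔣 (QuotientGroup.mk' (normInfty 𝔥 𝔣 G))
    (QuotientGroup.mk'_surjective _) (norm_quotient_normInfty 𝔥 𝔣 G)
  rwa [QuotientGroup.ker_mk'] at hker

/-! ### Minimal counterexamples -/

/-- `M` is the monolith of `G`: it is nontrivial, normal, and contained in every nontrivial normal
subgroup. -/
structure IsMonolith {G : Type*} [Group G] (M : Subgroup G) : Prop where
  normal : M.Normal
  ne_bot : M ≠ ⊥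
  le_of_normal : ∀ A : Subgroup G, A.Normal → A ≠ ⊥ → M ≤ A

theorem exists_minimal_quotient_notMem {G : Type u} [Group G] [Finite G] (hG : ¬ X.Mem G) :
    ∃ (N : Subgroup G) (_ : N.Normal), ¬ X.Mem (G ⧸ N) ∧
      ∀ (A : Subgroup (G ⧸ N)) [A.Normal], A ≠ ⊥ → X.Mem ((G ⧸ N) ⧸ A) := by
  obtain ⟨N, ⟨hN, hGN⟩, hmax⟩ := Set.Finite.exists_maximal
    (Set.toFinite {N : Subgroup G | ∃ _ : N.Normal, ¬ X.Mem (G ⧸ N)})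
    ⟨⊥, inferInstance, fun h => hG (X.mem_of_mulEquiv QuotientGroup.quotientBot h)⟩
  refine ⟨N, hN, hGN, fun A _ hA => ?_⟩
  by_contra hmem
  have hsurj := (QuotientGroup.mk'_surjective A).comp (QuotientGroup.mk'_surjective N)
  have hker : A.comap (QuotientGroup.mk' N) =
      ((QuotientGroup.mk' A).comp (QuotientGroup.mk' N)).ker := by
    rw [← MonoidHom.comap_ker, QuotientGroup.ker_mk']
  have e : G ⧸ A.comap (QuotientGroup.mk' N) ≃* (G ⧸ N) ⧸ A :=
    (QuotientGroup.quotientMulEquivOfEq hker).trans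
      (QuotientGroup.quotientKerEquivOfSurjective _ hsurj)
  have hle : A.comap (QuotientGroup.mk' N) ≤ N :=
    hmax ⟨inferInstance, fun h => hmem (X.mem_of_mulEquiv e h)⟩
      ((QuotientGroup.ker_mk' N).ge.trans (MonoidHom.ker_le_comap _ _))
  apply hA
  rwa [← Subgroup.map_comap_eq_self_of_surjective (QuotientGroup.mk'_surjective N) A,
    Subgroup.map_eq_bot_iff, QuotientGroup.ker_mk']

theorem isMonolith_residual (hX : X.IsFormation) {G : Type u} [Group G] [Finite G]
    (hG : ¬ X.Mem G) (hquot : ∀ (A : Subgroup G) [A.Normal], A ≠ ⊥ → X.Mem (G ⧸ A)) :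
    IsMonolith (X.residual G) where
  normal := inferInstance
  ne_bot h := hG ((hX.residual_eq_bot_iff G).1 h)
  le_of_normal A _ hA := sInf_le ⟨inferInstance, hquot A hA⟩

theorem IsMonolith.isPGroup_of_hasLocalRadical (hπ : piGroups πᶜ ≤ 𝔥) {G : Type u} [Group G]
    [Finite G] (hrad : 𝔥.radical G = ⊥) {M : Subgroup G} (hM : IsMonolith M)
    (h : HasLocalRadical π G) : ∃ q : ℕ, q.Prime ∧ IsPGroup q M := by
  rcases h with h | ⟨q, h⟩
  · exact absurd hrad (radical_ne_bot_of_mem inferInstance h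
      (hπ _ ((isFittingClass_piGroups πᶜ).radical_mem G)))
  · exact ⟨q, q.2, (piGroups_singleton_mem_iff q M).1 <| (isFittingClass_piGroups {q}).mem_of_le
      hM.normal (hM.le_of_normal _ inferInstance h) ((isFittingClass_piGroups {q}).radical_mem G)⟩

theorem IsMonolith.isMulCommutative_of_isPGroup {G : Type*} [Group G] [Finite G]
    {M : Subgroup G} (hM : IsMonolith M) {q : ℕ} [Fact q.Prime] (hq : IsPGroup q M) :
    IsMulCommutative M := by
  have := hM.normal
  have : Nontrivial M := (Subgroup.nontrivial_iff_ne_bot _).2 hM.ne_bot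
  have hle := hM.le_of_normal ((Subgroup.center M).map M.subtype) inferInstance (by
    rw [Ne, Subgroup.map_eq_bot_iff_of_injective _ M.subtype_injective]
    exact hq.bot_lt_center.ne')
  refine ⟨⟨fun a b => ?_⟩⟩
  obtain ⟨c, hc, hca⟩ := hle a.2
  obtain rfl : c = a := Subtype.ext hca
  exact (Subgroup.mem_center_iff.1 hc b).symm

/-! ### Monoliths inside the Frattini subgroup -/

theorem radical_quotient_eq_bot_of_le_frattini (h𝔥 : 𝔥.IsFittingClass) {G : Type u} [Group G]
    [Finite G] (hrad : 𝔥.radical G = ⊥) {M : Subgroup G} [M.Normal] [IsMulCommutative M]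
    (hM : M ≤ frattini G) (hco : (Nat.card M).Coprime (Nat.card (𝔥.radical (G ⧸ M)))) :
    𝔥.radical (G ⧸ M) = ⊥ := by
  set R := (𝔥.radical (G ⧸ M)).comap (QuotientGroup.mk' M)
  have hRmap : R.map (QuotientGroup.mk' M) = 𝔥.radical (G ⧸ M) :=
    Subgroup.map_comap_eq_self_of_surjective (QuotientGroup.mk'_surjective M) _
  have hrel : M.relIndex R = Nat.card (𝔥.radical (G ⧸ M)) := by
    conv_lhs => rw [← QuotientGroup.ker_mk' M, ← MonoidHom.comap_bot, Subgroup.relIndex_comap,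
      hRmap, Subgroup.relIndex_bot_left]
  obtain ⟨L, hL, hLM, hLR⟩ := exists_normal_complement_of_le_frattini (R := R)
    ((QuotientGroup.ker_mk' M).ge.trans (MonoidHom.ker_le_comap _ _)) hM (hrel ▸ hco)
  have hLmap : L.map (QuotientGroup.mk' M) = 𝔥.radical (G ⧸ M) := by
    rw [← hRmap, ← hLR, Subgroup.map_sup, (Subgroup.map_eq_bot_iff M).2
      (QuotientGroup.ker_mk' M).ge, sup_bot_eq]
  have hinj : Function.Injective ((QuotientGroup.mk' M).subgroupMap L) := by
    rw [← MonoidHom.ker_eq_bot_iff, Subgroup.ker_subgroupMap, QuotientGroup.ker_mk',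
      Subgroup.subgroupOf_eq_bot, disjoint_iff, inf_comm, hLM]
  have hLmem : 𝔥.Mem L := by
    refine 𝔥.mem_of_mulEquiv (MulEquiv.ofBijective _
      ⟨hinj, (QuotientGroup.mk' M).subgroupMap_surjective L⟩).symm ?_
    rw [hLmap]
    exact h𝔥.radical_mem _
  have hLbot : L = ⊥ := le_bot_iff.1 (hrad ▸ le_radical hL hLmem)
  rw [← hLmap, hLbot, Subgroup.map_bot]

theorem IsMonolith.radical_quotient_eq_bot (h𝔥F : 𝔥.IsFormation) (h𝔥 : 𝔥.IsFittingClass)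
    (hsat : 𝔥.IsSaturated) (hπ : piGroups πᶜ ≤ 𝔥) {G : Type u} [Group G] [Finite G]
    (hrad : 𝔥.radical G = ⊥) {M : Subgroup G} [M.Normal] (hM : IsMonolith M)
    (hfrattini : M ≤ frattini G) : 𝔥.radical (G ⧸ M) = ⊥ := by
  have : Nontrivial M := (Subgroup.nontrivial_iff_ne_bot _).2 hM.ne_bot
  have : Nontrivial (frattini G) :=
    (Subgroup.nontrivial_iff_ne_bot _).2 (ne_bot_of_le_ne_bot hM.ne_bot hfrattini)
  obtain ⟨q, hq, hMq⟩ := hM.isPGroup_of_hasLocalRadical hπ hrad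
    ((hasLocalRadical_of_isNilpotent frattini_nilpotent).of_normal inferInstance)
  have : Fact q.Prime := ⟨hq⟩
  have := hM.isMulCommutative_of_isPGroup hMq
  have hndvd : ¬ q ∣ Nat.card (𝔥.radical (G ⧸ M)) := fun hdvd =>
    h𝔥.radical_ne_bot_of_normal hM.normal
      (radical_ne_bot_of_isPGroup h𝔥F h𝔥 hsat (h𝔥.radical_mem _) hdvd hMq) hrad
  obtain ⟨n, hn⟩ := IsPGroup.iff_card.1 hMq
  exact radical_quotient_eq_bot_of_le_frattini h𝔥 hrad hfrattini
    (hn ▸ (hq.coprime_iff_not_dvd.2 hndvd).pow_left n)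

theorem IsFormation.isNilpotent_residual_of_quotient (h𝔣 : 𝔣.IsFormation) {G : Type u} [Group G]
    [Finite G] {M : Subgroup G} [M.Normal] (hM : M ≤ frattini G)
    (h : Group.IsNilpotent (𝔣.residual (G ⧸ M))) : Group.IsNilpotent (𝔣.residual G) := by
  rw [← h𝔣.map_residual_of_surjective (QuotientGroup.mk' M) (QuotientGroup.mk'_surjective M)] at h
  exact isNilpotent_of_map_mk_of_le_frattini _ M hM h

/-! ### Monoliths outside the Frattini subgroup -/

theorem normal_map_residual_of_sup_eq_top {G : Type u} [Group G] {H M : Subgroup G}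
    (hsup : H ⊔ M = ⊤)
    (hnorm : M ≤ Subgroup.normalizer ((X.residual H).map H.subtype : Set G)) :
    ((X.residual H).map H.subtype).Normal := by
  have hH : H ≤ Subgroup.normalizer ((X.residual H).map H.subtype : Set G) := by
    have := Subgroup.le_normalizer_map (H := X.residual H) H.subtype
    rwa [Subgroup.normalizer_eq_top, ← MonoidHom.range_eq_map, Subgroup.range_subtype] at this
  rw [← Subgroup.normalizer_eq_top_iff, eq_top_iff, ← hsup]
  exact sup_le hH hnorm

/-- A maximal subgroup `H` that does not contain `M` supplements it, so `M` normalizing the residual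
of `H` makes that residual normal; it does not contain the monolith, hence it is trivial and
`G ⧸ M`, a quotient of `H`, is in the formation. -/
theorem IsMonolith.residual_le_of_not_le_frattini (h𝔣 : 𝔣.IsFormation) {G : Type u} [Group G]
    [Finite G] {M : Subgroup G} [M.Normal] (hM : IsMonolith M)
    (hnorm : ∀ H : Subgroup G, M ≤ Subgroup.normalizer ((𝔣.residual H).map H.subtype : Set G))
    (hfrattini : ¬ M ≤ frattini G) : 𝔣.residual G ≤ M := by
  obtain ⟨H, hH, hMH⟩ : ∃ H : Subgroup G, IsCoatom H ∧ ¬ M ≤ H := by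
    by_contra! hcon
    exact hfrattini (le_iInf₂ hcon)
  have hsup : H ⊔ M = ⊤ := hH.2 _ (left_lt_sup.2 hMH)
  have hresidual : 𝔣.residual H = ⊥ := by
    by_contra hne
    refine hMH ((hM.le_of_normal _ (normal_map_residual_of_sup_eq_top hsup (hnorm H)) ?_).trans
      (Subgroup.map_subtype_le _))
    rwa [Ne, Subgroup.map_eq_bot_iff_of_injective _ H.subtype_injective]
  have hsurj : Function.Surjective ((QuotientGroup.mk' M).comp H.subtype) := by
    rw [← MonoidHom.range_eq_top, MonoidHom.range_comp, Subgroup.range_subtype,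
      ← Subgroup.map_top_of_surjective _ (QuotientGroup.mk'_surjective M), ← hsup,
      Subgroup.map_sup, (Subgroup.map_eq_bot_iff M).2 (QuotientGroup.ker_mk' M).ge, sup_bot_eq]
  exact sInf_le ⟨inferInstance, h𝔣.image _ hsurj ((h𝔣.residual_eq_bot_iff H).1 hresidual)⟩

theorem hasLocalRadical_of_piBoundaryI (h𝔣 : 𝔣.IsFormation) (hS : 𝔣 = 𝔣.subgroupClosure)
    (hI : PiBoundaryI π 𝔣) {G : Type u} [Group G] [Finite G] (hG : ¬ 𝔣.Mem G)
    {M : Subgroup G} (hM : M.Normal) (hresidual : 𝔣.residual G ≤ M)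
    (hnorm : ∀ H : Subgroup G, M ≤ Subgroup.normalizer ((𝔣.residual H).map H.subtype : Set G)) :
    HasLocalRadical π G := by
  obtain ⟨H, hH⟩ := exists_critical_subgroup hG
  have : Nontrivial (𝔣.residual H) :=
    (Subgroup.nontrivial_iff_ne_bot _).2 fun h => hH.2.1 ((h𝔣.residual_eq_bot_iff H).1 h)
  have hle : (𝔣.residual H).map H.subtype ≤ M :=
    (h𝔣.map_subtype_residual_le hS H).trans hresidual
  have hnormal : (((𝔣.residual H).map H.subtype).subgroupOf M).Normal :=
    (Subgroup.normal_subgroupOf_iff_le_normalizer hle).2 (hnorm H)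
  have e : 𝔣.residual H ≃* ((𝔣.residual H).map H.subtype).subgroupOf M :=
    ((𝔣.residual H).equivMapOfInjective _ H.subtype_injective).trans
      (Subgroup.subgroupOfEquivOfLe hle).symm
  exact (((hasLocalRadical_of_mem_piNilpotentGroups (hI H hH).2).of_mulEquiv e).of_normal
    hnormal).of_normal hM

theorem mem_fittingNilpotentProduct_of_norm_ne_bot (h𝔥F : 𝔥.IsFormation) (h𝔥 : 𝔥.IsFittingClass)
    (hsat : 𝔥.IsSaturated) (hπ : piGroups πᶜ ≤ 𝔥) (hE : 𝔥 = 𝔥.extensionClosure)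
    (h𝔣 : 𝔣.IsFormation) (hS : 𝔣 = 𝔣.subgroupClosure) {G : Type u} [Group G] [Finite G]
    (hcond : (piSolvableGroups π).Mem ((fittingNilpotentProduct 𝔥 𝔣).residual G) ∨
      PiBoundaryI π 𝔣)
    (hquot : ∀ (A : Subgroup G) [A.Normal], A ≠ ⊥ → (fittingNilpotentProduct 𝔥 𝔣).Mem (G ⧸ A))
    (hnorm : norm 𝔥 𝔣 G ≠ ⊥) : (fittingNilpotentProduct 𝔥 𝔣).Mem G := by
  have hY := isFormation_fittingNilpotentProduct h𝔥F h𝔥 h𝔣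
  by_contra hG
  have hnil : ¬ Group.IsNilpotent (𝔣.residual G) := fun h =>
    hG (mem_fittingNilpotentProduct_of_isNilpotent_residual h𝔣 h)
  have hrad : 𝔥.radical G = ⊥ := by
    by_contra hne
    exact hG (mem_fittingProduct_of_extension h𝔥 hE
      (isFormation_nilpotentGroups.formationProduct h𝔣) _ (h𝔥.radical_mem G) (hquot _ hne))
  set M := (fittingNilpotentProduct 𝔥 𝔣).residual G
  have hM : IsMonolith M := isMonolith_residual hY hG hquot
  have hMnorm (H : Subgroup G) :
      M ≤ Subgroup.normalizer ((𝔣.residual H).map H.subtype : Set G) :=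
    (hM.le_of_normal _ inferInstance hnorm).trans (norm_le_normalizer_of_radical_eq_bot hrad H)
  by_cases hfrattini : M ≤ frattini G
  · exact hnil (h𝔣.isNilpotent_residual_of_quotient hfrattini
      (isNilpotent_residual_of_radical_eq_bot
        (hM.radical_quotient_eq_bot h𝔥F h𝔥 hsat hπ hrad hfrattini) (hquot M hM.ne_bot)))
  have hresidual : 𝔣.residual G ≤ M := hM.residual_le_of_not_le_frattini h𝔣 hMnorm hfrattini
  have hlocal : HasLocalRadical π G := by
    rcases hcond with hsolvable | hboundary
    · have : Nontrivial M := (Subgroup.nontrivial_iff_ne_bot _).2 hM.ne_bot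
      exact (hasLocalRadical_of_mem_piSolvableGroups hsolvable).of_normal hM.normal
    · refine hasLocalRadical_of_piBoundaryI h𝔣 hS hboundary (fun hmem => hnil ?_) hM.normal
        hresidual hMnorm
      rw [(h𝔣.residual_eq_bot_iff G).2 hmem]
      infer_instance
  obtain ⟨q, hq, hMq⟩ := hM.isPGroup_of_hasLocalRadical hπ hrad hlocal
  have : Fact q.Prime := ⟨hq⟩
  exact hnil (hMq.to_le hresidual).isNilpotent

theorem mem_fittingNilpotentProduct_of_forall_norm_quotient_ne_bot (h𝔥F : 𝔥.IsFormation)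
    (h𝔥 : 𝔥.IsFittingClass) (hsat : 𝔥.IsSaturated) (hπ : piGroups πᶜ ≤ 𝔥)
    (hE : 𝔥 = 𝔥.extensionClosure) (h𝔣 : 𝔣.IsFormation) (hS : 𝔣 = 𝔣.subgroupClosure) {G : Type u}
    [Group G] [Finite G]
    (hcond : (piSolvableGroups π).Mem ((fittingNilpotentProduct 𝔥 𝔣).residual G) ∨
      PiBoundaryI π 𝔣)
    (hnorm : ∀ (N : Subgroup G) [N.Normal], N ≠ ⊤ → norm 𝔥 𝔣 (G ⧸ N) ≠ ⊥) :
    (fittingNilpotentProduct 𝔥 𝔣).Mem G := by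
  have hY := isFormation_fittingNilpotentProduct h𝔥F h𝔥 h𝔣
  by_contra hG
  obtain ⟨N, _, hGN, hquot⟩ := exists_minimal_quotient_notMem hG
  have hN : N ≠ ⊤ := by
    rintro rfl
    have := QuotientGroup.subsingleton_quotient_top (G := G)
    exact hGN (hY.mem_of_subsingleton _)
  refine hGN (mem_fittingNilpotentProduct_of_norm_ne_bot h𝔥F h𝔥 hsat hπ hE h𝔣 hS
    (hcond.imp_left fun h => ?_) hquot (hnorm N hN))
  rw [← hY.map_residual_of_surjective (QuotientGroup.mk' N) (QuotientGroup.mk'_surjective N)]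
  exact piSolvableGroups_image _ ((QuotientGroup.mk' N).subgroupMap_surjective _) h

end GroupClass

theorem theoremA (π : Set Nat.Primes) (𝔥 𝔣 : GroupClass.{u})
    (h_formation : 𝔥.IsFormation) (h_fitting : 𝔥.IsFittingClass) (h_saturated : 𝔥.IsSaturated)
    (h_pi : GroupClass.piGroups πᶜ ≤ 𝔥) (h_ext : 𝔥 = 𝔥.extensionClosure)
    (f_formation : 𝔣.IsFormation) (f_sub : 𝔣 = 𝔣.subgroupClosure)
    (G : Type u) [Group G] [Finite G]
    (h_cond : (GroupClass.piSolvableGroups π).Mem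
        ((GroupClass.fittingNilpotentProduct 𝔥 𝔣).residual G) ∨ GroupClass.PiBoundaryI π 𝔣) :
    List.TFAE [
      (GroupClass.fittingNilpotentProduct 𝔥 𝔣).Mem G,
      (GroupClass.fittingNilpotentProduct 𝔥 𝔣).Mem (G ⧸ GroupClass.norm 𝔥 𝔣 G),
      (GroupClass.fittingNilpotentProduct 𝔥 𝔣).Mem (G ⧸ GroupClass.normInfty 𝔥 𝔣 G),
      ∀ (N : Subgroup G) [N.Normal], N ≠ ⊤ → GroupClass.norm 𝔥 𝔣 (G ⧸ N) ≠ ⊥,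
      GroupClass.normInfty 𝔥 𝔣 G = ⊤] := by
  have hY := GroupClass.isFormation_fittingNilpotentProduct h_formation h_fitting f_formation
  tfae_have 1 → 2 := fun h => hY.image _ (QuotientGroup.mk'_surjective _) h
  tfae_have 2 → 3 := by
    intro h
    refine hY.mem_of_ker_le (QuotientGroup.mk' (GroupClass.norm 𝔥 𝔣 G))
      (QuotientGroup.mk' (GroupClass.normInfty 𝔥 𝔣 G)) (QuotientGroup.mk'_surjective _)
      (QuotientGroup.mk'_surjective _) ?_ h
    rw [QuotientGroup.ker_mk', QuotientGroup.ker_mk']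
    exact GroupClass.norm_le_normInfty h_formation h_fitting f_formation G
  tfae_have 3 → 5 := by
    intro h
    by_contra hne
    have : Nontrivial (G ⧸ GroupClass.normInfty 𝔥 𝔣 G) := QuotientGroup.nontrivial_iff.2 hne
    exact GroupClass.norm_ne_bot f_formation f_sub h (GroupClass.norm_quotient_normInfty 𝔥 𝔣 G)
  tfae_have 5 → 4 := fun h N _ hne hbot => hne <| top_le_iff.1 <|
    h ▸ GroupClass.normInfty_le_of_norm_quotient_eq_bot h_formation h_fitting f_formation hbot
  tfae_have 4 → 1 := GroupClass.mem_fittingNilpotentProduct_of_forall_norm_quotient_ne_bot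
    h_formation h_fitting h_saturated h_pi h_ext f_formation f_sub h_cond
  tfae_finish
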